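/- Let $d\ge 1$ and let $\psi:\mathbb R^d\to\mathbb R$ be smooth, with $\psi=0$ outside $[-3/4,3/4]^d$ and $\sum_{k\in\mathbb Z^d}\psi(\xi-k)=1$ for all $\xi\in\mathbb R^d$. For $j\in\mathbb Z$, $k\in\mathbb Z^d$ let $\Box_{j,k}=\mathscr F^{-1}\psi(2^{-j}\xi-k)\mathscr F$ on $\mathscr S'(\mathbb R^d)$, where $\mathscr F f(\xi)=\int e^{-i x\cdot\xi}f(x)\,dx$, and for $1\le p\le\infty$ put $$\|f\|_{M^{[j]}_{p,1}}=\sum_{k\in\mathbb Z^d}\|\Box_{j,k}f\|_{L^p(\mathbb R^d)}\in[0,\infty].$$ For $1\le r<\infty$, $\mu\in\mathbb R$ and a set $J\subset\mathbb Z$ of scales, consider the space of all tempered distributions $f$ for which $$\inf\Big\{\Big(\sum_{j\in J}2^{jr\mu}\|f_j\|^r_{M^{[j]}_{p,1}}\Big)^{1/r}:\ f=\sum_{j\in J}f_j \text{ in }\mathscr S'(\mathbb R^d)\Big\}$$ is finite, normed by this infimum. It is denoted by $\dot{\mathscr M}^{\mu}_{p,1,r}$ (full homogeneous space) if $J=\mathbb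 Z$, and by $\tilde{\mathscr M}^{\mu}_{p,1,r}$ (rough space) if $J=\{j\in\mathbb Z: j\ge 0\}$. We say that such a space $X$ is a Banach algebra if it is a Banach space, its elements are bounded continuous functions, and there is a constant $C$ such that for all $f,g\in X$ the pointwise product $fg$ lies in $X$ and $\|fg\|_X\le C\|f\|_X\|g\|_X$. Let $1\le p<\infty$ and $1/p+1/p'=1$. Then: (i) $\dot{\mathscr M}^{d/p}_{p,1,1}$ is a Banach algebra. (ii) $\tilde{\mathscr M}^{\mu}_{p,1,1}$ is a Banach algebra for every $\mu\in[d/p,\max(d/p,d/p')]$. (iii) If $p>p'$, then $\tilde{\mathscr M}^{\mu}_{p,1,r}$ is a Banach algebra for every $1<r<\infty$ and every $\mu$ with $d/p<\mu\le d/p'$. -/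

import Mathlib

open MeasureTheory Set Filter Topology
open scoped ENNReal NNReal SchwartzMap BoundedContinuousFunction

noncomputable section

namespace ScalingLimit

/-- Euclidean space `ℝ^d`. -/
abbrev Eu (d : ℕ) : Type := EuclideanSpace ℝ (Fin d)

/-- The point of `ℝ^d` with the integer coordinates `k`. -/
def latticePoint {d : ℕ} (k : Fin d → ℤ) : Eu d := WithLp.toLp 2 fun i => (k i : ℝ)

/-- Admissible frequency windows: `ψ` is smooth, vanishes outside the cube `[-3/4, 3/4]^d`, and its
integer translates form a partition of unity. -/
structure IsWindow {d : ℕ} (ψ : Eu d → ℝ) : Prop where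
  smooth : ContDiff ℝ (⊤ : ℕ∞) ψ
  support : ∀ ξ : Eu d, (∃ i, 3 / 4 < |ξ i|) → ψ ξ = 0
  partition : ∀ ξ : Eu d, HasSum (fun k : Fin d → ℤ => ψ (ξ - latticePoint k)) 1

/-- The frequency localisation `□_{j,k} = 𝓕⁻¹ ψ(2^{-j} ξ - k) 𝓕` on tempered distributions. Here `ξ`
is the angular frequency, i.e. `𝓕 f(ξ) = ∫ e^{-i x·ξ} f(x) dx` up to a constant factor. Mathlib's
Fourier transform uses `e^{-2π i x·η}` instead, so that `ξ = 2π η`. -/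
def box {d : ℕ} (ψ : Eu d → ℝ) (j : ℤ) (k : Fin d → ℤ) (f : 𝓢'(Eu d, ℂ)) : 𝓢'(Eu d, ℂ) :=
  TemperedDistribution.fourierMultiplierCLM ℂ
    (fun η : Eu d => ((ψ ((2 : ℝ) ^ (-j) • ((2 * Real.pi) • η) - latticePoint k) : ℝ) : ℂ)) f

/-- The `L^p` norm of a tempered distribution: the `L^p` norm of the (unique) function in `L^p` that
represents it, and `∞` if there is no such function. -/
def distLpNorm {d : ℕ} (p : ℝ≥0∞) [Fact (1 ≤ p)] (f : 𝓢'(Eu d, ℂ)) : ℝ≥0∞ :=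
  ⨅ (g : Lp ℂ p (volume : Measure (Eu d))) (_ : Lp.toTemperedDistribution g = f), ‖g‖ₑ

/-- The `ℓ^q` norm of a family in `[0, ∞]`, for a finite exponent `q`. -/
def ellNorm {ι : Type*} (q : ℝ) (a : ι → ℝ≥0∞) : ℝ≥0∞ := (∑' i, a i ^ q) ^ (1 / q)

/-- The norm `‖f‖_{M^{[j]}_{p,q}} = ‖ ‖□_{j,k} f‖_{L^p} ‖_{ℓ^q_k}`, with the value `∞` allowed. -/
def modNorm {d : ℕ} (ψ : Eu d → ℝ) (p : ℝ≥0∞) [Fact (1 ≤ p)] (q : ℝ) (j : ℤ)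
    (f : 𝓢'(Eu d, ℂ)) : ℝ≥0∞ :=
  ellNorm q fun k : Fin d → ℤ => distLpNorm p (box ψ j k f)

/-- The infimum of `(∑_{j ∈ J} 2^{j r μ} ‖f_j‖^r_{M^{[j]}_{p,q}})^{1/r}` over all decompositions
`f = ∑_{j ∈ J} f_j` that converge in the space of tempered distributions; it is `∞` if no
decomposition makes it finite. The scaling limit space belonging to the set `J` of scales consists
of all `f` for which it is finite, and it is the norm of that space. -/
def scalingNorm {d : ℕ} (ψ : Eu d → ℝ) (J : Set ℤ) (p : ℝ≥0∞) [Fact (1 ≤ p)] (q r μ : ℝ)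
    (f : 𝓢'(Eu d, ℂ)) : ℝ≥0∞ :=
  ⨅ (F : J → 𝓢'(Eu d, ℂ)) (_ : HasSum F f),
    ellNorm r fun j : J => (2 : ℝ≥0∞) ^ (((j : ℤ) : ℝ) * μ) * modNorm ψ p q (j : ℤ) (F j)

/-- The norm of the full homogeneous space, with all scales `j ∈ ℤ`. -/
def fullNorm {d : ℕ} (ψ : Eu d → ℝ) (p : ℝ≥0∞) [Fact (1 ≤ p)] (q r μ : ℝ) :
    𝓢'(Eu d, ℂ) → ℝ≥0∞ :=
  scalingNorm ψ Set.univ p q r μ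

/-- The norm of the rough space, with the scales `j ≥ 0`. -/
def roughNorm {d : ℕ} (ψ : Eu d → ℝ) (p : ℝ≥0∞) [Fact (1 ≤ p)] (q r μ : ℝ) :
    𝓢'(Eu d, ℂ) → ℝ≥0∞ :=
  scalingNorm ψ (Set.Ici 0) p q r μ

/-- The tempered distribution `f` is the bounded continuous function `u`. -/
def IsRepresentedBy {d : ℕ} (f : 𝓢'(Eu d, ℂ)) (u : Eu d →ᵇ ℂ) : Prop :=
  ∀ φ : 𝓢(Eu d, ℂ), f φ = ∫ x, φ x * u x

/-- The space `{f | N f < ∞}` of tempered distributions with the norm `N` is a Banach algebra under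
pointwise multiplication: `N` is a norm on it and it is complete, its elements are bounded
continuous functions, and it is closed under products, with `N (f g) ≤ C N f N g` for a constant
`C`. (So the norm `C N`, for a `C > 0`, is submultiplicative.) -/
structure IsBanachAlgebra {d : ℕ} (N : 𝓢'(Eu d, ℂ) → ℝ≥0∞) : Prop where
  smul : ∀ (c : ℂ) (f : 𝓢'(Eu d, ℂ)), N (c • f) = ‖c‖ₑ * N f
  add_le : ∀ f g : 𝓢'(Eu d, ℂ), N (f + g) ≤ N f + N g
  eq_zero : ∀ f : 𝓢'(Eu d, ℂ), N f = 0 → f = 0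
  complete : ∀ F : ℕ → 𝓢'(Eu d, ℂ), (∀ n, N (F n) < ∞) →
    (∀ ε : ℝ≥0∞, 0 < ε → ∃ n₀, ∀ m ≥ n₀, ∀ n ≥ n₀, N (F m - F n) < ε) →
    ∃ f, N f < ∞ ∧ Tendsto (fun n => N (F n - f)) atTop (𝓝 0)
  bounded_continuous : ∀ f : 𝓢'(Eu d, ℂ), N f < ∞ → ∃ u : Eu d →ᵇ ℂ, IsRepresentedBy f u
  mul : ∃ C : ℝ≥0, ∀ (f g : 𝓢'(Eu d, ℂ)) (u v : Eu d →ᵇ ℂ), N f < ∞ → N g < ∞ →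
    IsRepresentedBy f u → IsRepresentedBy g v →
    ∃ h, IsRepresentedBy h (u * v) ∧ N h < ∞ ∧ N h ≤ C * N f * N g

end ScalingLimit

end

/-! Everything rests on the critical exponent `s = d/p`. The kernel of a multiplier `χ(aη - c)` is,
up to a modulation, a dilation of one fixed Schwartz kernel. Hence these multipliers are bounded on
`L^p` uniformly in `a` and `c`, and they map `L^p` to `L^∞` with norm `≲ a^{-d/p}`
(`IsCutoff.exists_multiplier_bound`). A piece `□_{j,k} f` is therefore a bounded continuous function
with sup norm `≲ 2^{js}` times its `L^p` norm; summing over `k` bounds the sup norm of `f` by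
`2^{js} ‖f‖_{M^{[j]}_{p,1}}` (`IsWindow.exists_embedding`).

For `l ≤ j`, multiplying a piece of scale `j` by a piece of scale `l` gives a function whose
spectrum has bounded size in units of `2^j`, so only boundedly many `□_{j,k'}` see it. Taking the
`L^p` norm of the first factor and the sup norm of the second gives `‖uv‖_{M^{[j]}} ≲ ‖u‖_{M^{[j]}}
2^{ls} ‖v‖_{M^{[l]}}` (`IsWindow.exists_modNorm_mul_le`).

Given `f = ∑ f_j` and `g = ∑ g_j`, the terms of `fg` are collected at the higher of the two scales:
`h_j = f_j ∑_{l ≤ j} g_l + g_j ∑_{l < j} f_l`. The inner sums cost at most `∑_l 2^{ls} ‖g_l‖` and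
`∑_l 2^{ls} ‖f_l‖`, so the product estimate follows once the norm of a decomposition dominates these
sums. That is `WeightControl`, the only property of `J`, `r`, `μ` that is needed: an identity for `r
= 1`, `μ = s`; monotonicity of the weights for `j ≥ 0`, `μ ≥ s`; Hölder and a geometric series for
`r > 1`, `μ > s`. The same control makes decompositions converge absolutely in the sup norm, which
gives definiteness, the triangle inequality and completeness. -/

noncomputable section

namespace ScalingLimit

open FourierTransform

/-! ### Convolution estimates of Young and Bernstein type -/

section Convolution

/-- Weighted Jensen inequality, in the form used for convolutions. -/
theorem enorm_integral_mul_rpow_le {α : Type*} [MeasurableSpace α] {ν : Measure α} {K f : α → ℂ}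
    (hK : AEMeasurable K ν) (hf : AEMeasurable f ν) {p : ℝ} (hp : 1 ≤ p) {A : ℝ≥0∞}
    (hA : ∫⁻ y, ‖K y‖ₑ ∂ν ≤ A) :
    ‖∫ y, K y * f y ∂ν‖ₑ ^ p ≤ A ^ (p - 1) * ∫⁻ y, ‖K y‖ₑ * ‖f y‖ₑ ^ p ∂ν := by
  have hp0 : 0 < p := by linarith
  rcases hp.eq_or_lt with rfl | hp1
  · simp only [ENNReal.rpow_one, sub_self, ENNReal.rpow_zero, one_mul]
    refine (enorm_integral_le_lintegral_enorm _).trans (le_of_eq ?_)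
    simp
  have hpq := Real.HolderConjugate.conjExponent hp1
  set q := p.conjExponent
  have hq0 : 0 < q := hpq.symm.pos
  -- Hölder after splitting `‖K‖ = ‖K‖^{1/q} ‖K‖^{1/p}`, so that only the second part stays with
  -- `f`.
  have h1 : ‖∫ y, K y * f y ∂ν‖ₑ ≤
      (∫⁻ y, (‖K y‖ₑ ^ (1 / q)) ^ q ∂ν) ^ (1 / q) *
        (∫⁻ y, (‖K y‖ₑ ^ (1 / p) * ‖f y‖ₑ) ^ p ∂ν) ^ (1 / p) := by
    refine (enorm_integral_le_lintegral_enorm _).trans ?_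
    refine le_trans (le_of_eq ?_) (ENNReal.lintegral_mul_le_Lp_mul_Lq ν hpq.symm
      (hK.enorm.pow_const _) ((hK.enorm.pow_const _).mul hf.enorm))
    refine lintegral_congr fun y => ?_
    simp only [Pi.mul_apply, enorm_mul]
    rw [← mul_assoc, ← ENNReal.rpow_add_of_nonneg _ _ (by positivity) (by positivity)]
    have : 1 / q + 1 / p = 1 := by simpa using hpq.symm.inv_add_inv_eq_one
    rw [this, ENNReal.rpow_one]
  have h2 : ∀ y, (‖K y‖ₑ ^ (1 / q)) ^ q = ‖K y‖ₑ := fun y => by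
    rw [← ENNReal.rpow_mul, one_div, inv_mul_cancel₀ hq0.ne', ENNReal.rpow_one]
  have h3 : ∀ y, (‖K y‖ₑ ^ (1 / p) * ‖f y‖ₑ) ^ p = ‖K y‖ₑ * ‖f y‖ₑ ^ p := fun y => by
    rw [ENNReal.mul_rpow_of_nonneg _ _ hp0.le, ← ENNReal.rpow_mul, one_div,
      inv_mul_cancel₀ hp0.ne', ENNReal.rpow_one]
  simp only [h2, h3] at h1
  have h4 := ENNReal.rpow_le_rpow h1 hp0.le
  rw [ENNReal.mul_rpow_of_nonneg _ _ hp0.le, ← ENNReal.rpow_mul, ← ENNReal.rpow_mul,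
    one_div_mul_cancel hp0.ne', ENNReal.rpow_one] at h4
  refine h4.trans ?_
  gcongr
  have : 1 / q * p = p - 1 := by
    have := hpq.inv_add_inv_eq_one
    field_simp at this ⊢
    linarith
  rw [this]
  exact ENNReal.rpow_le_rpow hA (by linarith)

variable {d : ℕ}

/-- The convolution of Schwartz functions. -/
def conv (K φ : 𝓢(Eu d, ℂ)) : 𝓢(Eu d, ℂ) :=
  SchwartzMap.convolution (ContinuousLinearMap.mul ℂ ℂ) K φ

theorem conv_apply (K φ : 𝓢(Eu d, ℂ)) (x : Eu d) : conv K φ x = ∫ y, K y * φ (x - y) := by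
  rw [conv, SchwartzMap.convolution_apply]
  rfl

theorem enorm_conv_rpow_le (K φ : 𝓢(Eu d, ℂ)) {p : ℝ} (hp : 1 ≤ p) {A : ℝ≥0∞}
    (hA : ∫⁻ y, ‖K y‖ₑ ≤ A) (x : Eu d) :
    ‖conv K φ x‖ₑ ^ p ≤ A ^ (p - 1) * ∫⁻ y, ‖K y‖ₑ * ‖φ (x - y)‖ₑ ^ p := by
  rw [conv_apply]
  exact enorm_integral_mul_rpow_le K.continuous.aemeasurable
    (φ.continuous.comp (by fun_prop)).aemeasurable hp hA

/-- Young's inequality: the pointwise Jensen bound is integrated in `x`, then Tonelli and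
translation invariance supply the last factor `A`. -/
theorem eLpNorm_conv_le (K φ : 𝓢(Eu d, ℂ)) {p : ℝ≥0∞} (hp : 1 ≤ p) (hpt : p ≠ ∞) {A : ℝ≥0∞}
    (hA : ∫⁻ y, ‖K y‖ₑ ≤ A) : eLpNorm (conv K φ) p volume ≤ A * eLpNorm φ p volume := by
  have hp0 : p ≠ 0 := (zero_lt_one.trans_le hp).ne'
  have hp1 : 1 ≤ p.toReal := by
    rw [← ENNReal.toReal_one]; exact ENNReal.toReal_mono hpt hp
  have hpp : 0 < p.toReal := by linarith
  rw [eLpNorm_eq_lintegral_rpow_enorm_toReal hp0 hpt, eLpNorm_eq_lintegral_rpow_enorm_toReal hp0 hpt]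
  rw [← ENNReal.rpow_le_rpow_iff hpp, ENNReal.mul_rpow_of_nonneg _ _ hpp.le, ← ENNReal.rpow_mul,
    ← ENNReal.rpow_mul, one_div_mul_cancel hpp.ne', ENNReal.rpow_one, ENNReal.rpow_one]
  have hKm : Measurable fun y => ‖K y‖ₑ := K.continuous.measurable.enorm
  have hφm : Measurable fun y => ‖φ y‖ₑ ^ p.toReal := φ.continuous.measurable.enorm.pow_const _
  have hm : Measurable fun z : Eu d × Eu d => ‖K z.2‖ₑ * ‖φ (z.1 - z.2)‖ₑ ^ p.toReal :=
    (hKm.comp measurable_snd).mul (hφm.comp (measurable_fst.sub measurable_snd))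
  calc ∫⁻ x, ‖conv K φ x‖ₑ ^ p.toReal
      ≤ ∫⁻ x, A ^ (p.toReal - 1) * ∫⁻ y, ‖K y‖ₑ * ‖φ (x - y)‖ₑ ^ p.toReal :=
        lintegral_mono fun x => enorm_conv_rpow_le K φ hp1 hA x
    _ = A ^ (p.toReal - 1) * ∫⁻ y, ∫⁻ x, ‖K y‖ₑ * ‖φ (x - y)‖ₑ ^ p.toReal := by
        rw [lintegral_const_mul _ hm.lintegral_prod_right, lintegral_lintegral_swap hm.aemeasurable]
    _ = A ^ (p.toReal - 1) * ((∫⁻ y, ‖K y‖ₑ) * ∫⁻ x, ‖φ x‖ₑ ^ p.toReal) := by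
        congr 1
        rw [← lintegral_mul_const _ hKm]
        refine lintegral_congr fun y => ?_
        have hφy : Measurable fun x => ‖φ (x - y)‖ₑ ^ p.toReal := hφm.comp (measurable_id.sub_const y)
        rw [lintegral_const_mul _ hφy,
          lintegral_sub_right_eq_self (fun x => ‖φ x‖ₑ ^ p.toReal) y]
    _ ≤ A ^ (p.toReal - 1) * (A * ∫⁻ x, ‖φ x‖ₑ ^ p.toReal) := by gcongr
    _ = A ^ p.toReal * ∫⁻ x, ‖φ x‖ₑ ^ p.toReal := by
        rw [← mul_assoc]
        congr 1
        conv_lhs => rw [← ENNReal.rpow_one A, ← ENNReal.rpow_mul, one_mul]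
        rw [← ENNReal.rpow_add_of_nonneg _ _ (by linarith) zero_le_one]
        simp

/-- Jensen leaves a single factor `‖K y‖` under the integral; bounding it by `A * B` gives `A^p * B`
in the `p`-th power. With `B = a^{-d}` this is Bernstein's inequality. -/
theorem enorm_conv_le (K φ : 𝓢(Eu d, ℂ)) {p : ℝ≥0∞} (hp : 1 ≤ p) (hpt : p ≠ ∞) {A B : ℝ≥0∞}
    (hA : ∫⁻ y, ‖K y‖ₑ ≤ A) (hB : ∀ y, ‖K y‖ₑ ≤ A * B) (x : Eu d) :
    ‖conv K φ x‖ₑ ≤ A * B ^ (p⁻¹).toReal * eLpNorm φ p volume := by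
  have hp0 : p ≠ 0 := (zero_lt_one.trans_le hp).ne'
  have hp1 : 1 ≤ p.toReal := by
    rw [← ENNReal.toReal_one]; exact ENNReal.toReal_mono hpt hp
  have hpp : 0 < p.toReal := by linarith
  rw [eLpNorm_eq_lintegral_rpow_enorm_toReal hp0 hpt]
  rw [← ENNReal.rpow_le_rpow_iff hpp, ENNReal.mul_rpow_of_nonneg _ _ hpp.le,
    ENNReal.mul_rpow_of_nonneg _ _ hpp.le, ← ENNReal.rpow_mul,
    ← ENNReal.rpow_mul, one_div_mul_cancel hpp.ne', ENNReal.rpow_one, ENNReal.toReal_inv,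
    inv_mul_cancel₀ hpp.ne', ENNReal.rpow_one]
  have hφm : Measurable fun y => ‖φ y‖ₑ ^ p.toReal := φ.continuous.measurable.enorm.pow_const _
  calc ‖conv K φ x‖ₑ ^ p.toReal
      ≤ A ^ (p.toReal - 1) * ∫⁻ y, ‖K y‖ₑ * ‖φ (x - y)‖ₑ ^ p.toReal :=
        enorm_conv_rpow_le K φ hp1 hA x
    _ ≤ A ^ (p.toReal - 1) * ∫⁻ y, A * B * ‖φ (x - y)‖ₑ ^ p.toReal := by
        gcongr with y
        exact hB y
    _ = A ^ (p.toReal - 1) * (A * B * ∫⁻ x, ‖φ x‖ₑ ^ p.toReal) := by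
        have hφx : Measurable fun y => ‖φ (x - y)‖ₑ ^ p.toReal := hφm.comp (measurable_id.const_sub x)
        rw [lintegral_const_mul _ hφx,
          lintegral_sub_left_eq_self (fun x => ‖φ x‖ₑ ^ p.toReal) x]
    _ = A ^ p.toReal * B * ∫⁻ x, ‖φ x‖ₑ ^ p.toReal := by
        rw [← mul_assoc, ← mul_assoc]
        congr 2
        conv_lhs => rw [← ENNReal.rpow_one A, ← ENNReal.rpow_mul, one_mul]
        rw [← ENNReal.rpow_add_of_nonneg _ _ (by linarith) zero_le_one]
        simp

end Convolution

/-! ### Multiplier kernels, truncation, and spectra of products of Schwartz functions -/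

section Schwartz

variable {d : ℕ}

/-- The symbol `χ(a η - c)`. -/
def symbol (χ : Eu d → ℝ) (a : ℝ) (c : Eu d) (η : Eu d) : ℂ := (χ (a • η - c) : ℝ)

/-- Smooth functions with compact support. -/
structure IsCutoff (χ : Eu d → ℝ) : Prop where
  smooth : ContDiff ℝ (⊤ : ℕ∞) χ
  compact : HasCompactSupport χ

theorem IsCutoff.contDiff_symbol {χ : Eu d → ℝ} (h : IsCutoff χ) (a : ℝ) (c : Eu d) :
    ContDiff ℝ (⊤ : ℕ∞) (symbol χ a c) :=
  Complex.ofRealCLM.contDiff.comp (h.smooth.comp (by fun_prop))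

theorem IsCutoff.hasCompactSupport_symbol {χ : Eu d → ℝ} (h : IsCutoff χ) {a : ℝ} (ha : a ≠ 0)
    (c : Eu d) : HasCompactSupport (symbol χ a c) := by
  have h1 : HasCompactSupport fun η : Eu d => χ (a • η - c) :=
    h.compact.comp_homeomorph ((Homeomorph.smulOfNeZero a ha).trans (Homeomorph.subRight c))
  exact h1.comp_left (g := ((↑) : ℝ → ℂ)) rfl

theorem IsCutoff.hasTemperateGrowth_symbol {χ : Eu d → ℝ} (h : IsCutoff χ) {a : ℝ} (ha : a ≠ 0)
    (c : Eu d) : (symbol χ a c).HasTemperateGrowth :=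
  (h.hasCompactSupport_symbol ha c).hasTemperateGrowth (h.contDiff_symbol a c)

/-- The convolution kernel of the Fourier multiplier `χ(a η - c)`. -/
def IsCutoff.kernel {χ : Eu d → ℝ} (h : IsCutoff χ) {a : ℝ} (ha : a ≠ 0) (c : Eu d) :
    𝓢(Eu d, ℂ) :=
  𝓕⁻ ((h.hasCompactSupport_symbol ha c).toSchwartzMap (h.contDiff_symbol a c))

theorem IsCutoff.fourierMultiplierCLM_eq_conv {χ : Eu d → ℝ} (h : IsCutoff χ) {a : ℝ} (ha : a ≠ 0)
    (c : Eu d) (φ : 𝓢(Eu d, ℂ)) :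
    SchwartzMap.fourierMultiplierCLM ℂ (symbol χ a c) φ = conv (h.kernel ha c) φ := by
  rw [SchwartzMap.fourierMultiplierCLM_apply, conv]
  change _ = 𝓕⁻ (SchwartzMap.pairing (ContinuousLinearMap.mul ℂ ℂ) (𝓕 (h.kernel ha c)) (𝓕 φ))
  congr 1
  ext η
  rw [SchwartzMap.smulLeftCLM_apply_apply (h.hasTemperateGrowth_symbol ha c),
    SchwartzMap.pairing_apply_apply, IsCutoff.kernel, fourier_fourierInv_eq]
  rfl

/-- The substitution `ζ = aη - c` in the inverse Fourier integral turns the shift by `c` into a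
unimodular factor and the scaling into a dilation. -/
theorem IsCutoff.norm_kernel {χ : Eu d → ℝ} (h : IsCutoff χ) {a : ℝ} (ha : 0 < a) (c x : Eu d) :
    ‖h.kernel ha.ne' c x‖ = (a ^ d)⁻¹ * ‖h.kernel one_ne_zero 0 (a⁻¹ • x)‖ := by
  simp only [IsCutoff.kernel, SchwartzMap.fourierInv_coe, Real.fourierInv_eq]
  have h1 : ∀ η : Eu d, Real.fourierChar (inner ℝ η x) •
      ((h.hasCompactSupport_symbol ha.ne' c).toSchwartzMap (h.contDiff_symbol a c)) η =
      (fun ζ : Eu d => Real.fourierChar (inner ℝ (ζ + c) (a⁻¹ • x)) • ((χ ζ : ℝ) : ℂ)) (a • η - c) := by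
    intro η
    simp only [sub_add_cancel, inner_smul_left, inner_smul_right]
    congr 2
    simp [ha.ne']
  have h2 : ∀ ζ : Eu d, Real.fourierChar (inner ℝ (ζ + c) (a⁻¹ • x)) • ((χ ζ : ℝ) : ℂ) =
      (Real.fourierChar (inner ℝ c (a⁻¹ • x)) : ℂ) * (Real.fourierChar (inner ℝ ζ (a⁻¹ • x)) •
      ((h.hasCompactSupport_symbol one_ne_zero 0).toSchwartzMap (h.contDiff_symbol 1 0)) ζ) := by
    intro ζ
    rw [inner_add_left, add_comm, AddChar.map_add_eq_mul, mul_smul, Circle.smul_def]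
    congr 2
    change _ = ((χ ((1 : ℝ) • ζ - 0) : ℝ) : ℂ)
    simp
  rw [integral_congr_ae (Eventually.of_forall h1)]
  rw [Measure.integral_comp_smul volume (fun ζ : Eu d =>
    (fun ζ : Eu d => Real.fourierChar (inner ℝ (ζ + c) (a⁻¹ • x)) • ((χ ζ : ℝ) : ℂ)) (ζ - c)) a,
    integral_sub_right_eq_self (fun ζ : Eu d =>
      Real.fourierChar (inner ℝ (ζ + c) (a⁻¹ • x)) • ((χ ζ : ℝ) : ℂ)) c,
    integral_congr_ae (Eventually.of_forall h2), integral_const_mul, norm_smul,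
    norm_mul, Circle.norm_coe, one_mul]
  simp [abs_of_pos ha]

theorem IsCutoff.exists_kernel_bound {χ : Eu d → ℝ} (h : IsCutoff χ) :
    ∃ A : ℝ≥0, ∀ (a : ℝ) (ha : 0 < a) (c : Eu d), ∫⁻ y, ‖h.kernel ha.ne' c y‖ₑ ≤ A ∧
      ∀ y, ‖h.kernel ha.ne' c y‖ₑ ≤ A * ENNReal.ofReal (a ^ d)⁻¹ := by
  set K := h.kernel one_ne_zero 0
  obtain ⟨B, hB0, hB⟩ := K.decay 0 0
  have hI : 0 ≤ ∫ y, ‖K y‖ := integral_nonneg fun _ => norm_nonneg _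
  -- The sum of the sup bound and the `L^1` norm of the unscaled kernel serves both estimates; the
  -- `L^1` norm is invariant under the dilation.
  refine ⟨(B + ∫ y, ‖K y‖).toNNReal, fun a ha c => ⟨?_, fun y => ?_⟩⟩
  · rw [← ofReal_integral_norm_eq_lintegral_enorm (SchwartzMap.integrable _)]
    simp only [h.norm_kernel ha c]
    rw [integral_const_mul, Measure.integral_comp_smul volume (fun y => ‖K y‖) a⁻¹]
    refine ENNReal.ofReal_le_ofReal ?_
    simp only [finrank_euclideanSpace, Fintype.card_fin, inv_pow, inv_inv, smul_eq_mul]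
    rw [abs_of_pos (by positivity), inv_mul_cancel_left₀ (by positivity)]
    linarith
  · rw [← ofReal_norm, h.norm_kernel ha c]
    change _ ≤ ENNReal.ofReal _ * _
    rw [← ENNReal.ofReal_mul (by positivity), mul_comm]
    refine ENNReal.ofReal_le_ofReal ?_
    gcongr
    have := hB (a⁻¹ • y)
    simp only [pow_zero, norm_iteratedFDeriv_zero, one_mul] at this
    linarith

/-- The convolution theorem is applied to the inverse transforms and then reflected by `𝓕⁻ f η = 𝓕 f
(-η)`, which accounts for the signs. -/
theorem fourier_pairing_apply (φ₁ φ₂ : 𝓢(Eu d, ℂ)) (ζ : Eu d) :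
    𝓕 (SchwartzMap.pairing (ContinuousLinearMap.mul ℂ ℂ) φ₁ φ₂) ζ =
      ∫ η, 𝓕 φ₁ (-η) * 𝓕 φ₂ (ζ + η) := by
  have h1 : 𝓕⁻ (SchwartzMap.pairing (ContinuousLinearMap.mul ℂ ℂ) φ₁ φ₂) =
      conv (𝓕⁻ φ₁) (𝓕⁻ φ₂) := by
    have h (g : 𝓢(Eu d, ℂ)) : 𝓕⁻ (𝓕 g : 𝓢(Eu d, ℂ)) = g := fourierInv_fourier_eq g
    rw [conv, ← h (SchwartzMap.convolution (ContinuousLinearMap.mul ℂ ℂ) (𝓕⁻ φ₁) (𝓕⁻ φ₂)),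
      SchwartzMap.fourier_convolution, fourier_fourierInv_eq, fourier_fourierInv_eq]
  have h2 : ∀ (f : 𝓢(Eu d, ℂ)) (η : Eu d), 𝓕⁻ f η = 𝓕 f (-η) := fun f η => by
    rw [SchwartzMap.fourierInv_apply_eq]; rfl
  have h3 := h2 (SchwartzMap.pairing (ContinuousLinearMap.mul ℂ ℂ) φ₁ φ₂) (-ζ)
  rw [neg_neg] at h3
  rw [← h3, h1, conv_apply]
  refine integral_congr_ae (Eventually.of_forall fun η => ?_)
  simp only [h2]
  congr 2
  abel

/-- Truncation by `χ(x/(n+1))`. The error `θ(c n • x) φ(x)` vanishes where `‖c n • x‖ < 1`;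
elsewhere `1 ≤ c n * ‖x‖`, so one extra power of `‖x‖`, absorbed by the decay of `φ`, buys a factor
`c n → 0`. -/
theorem exists_tendsto_hasCompactSupport (φ : 𝓢(Eu d, ℂ)) :
    ∃ φn : ℕ → 𝓢(Eu d, ℂ), (∀ n, HasCompactSupport (φn n)) ∧ Tendsto φn atTop (𝓝 φ) := by
  let χ : ContDiffBump (0 : Eu d) := ⟨1, 2, one_pos, one_lt_two⟩
  have hχc : IsCutoff χ := ⟨χ.contDiff, χ.hasCompactSupport⟩
  let c : ℕ → ℝ := fun n => ((n : ℝ) + 1)⁻¹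
  have hc0 : ∀ n, 0 < c n := fun n => by positivity
  have hc1 : ∀ n, c n ≤ 1 := fun n => inv_le_one_of_one_le₀ (by simp)
  let θ : Eu d → ℂ := fun x => symbol χ 1 0 x - 1
  have hθs : ContDiff ℝ (⊤ : ℕ∞) θ := (hχc.contDiff_symbol 1 0).sub contDiff_const
  have hθt : θ.HasTemperateGrowth :=
    (hχc.hasTemperateGrowth_symbol one_ne_zero 0).sub (.const 1)
  refine ⟨fun n => SchwartzMap.smulLeftCLM ℂ (symbol χ (c n) 0) φ, fun n => ?_, ?_⟩
  · rw [SchwartzMap.smulLeftCLM_apply (hχc.hasTemperateGrowth_symbol (hc0 n).ne' 0)]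
    exact (hχc.hasCompactSupport_symbol (hc0 n).ne' 0).smul_right
  have hdiff : ∀ n, ⇑(SchwartzMap.smulLeftCLM ℂ (symbol χ (c n) 0) φ - φ) =
      fun x => θ (c n • x) * φ x := by
    intro n
    ext x
    rw [sub_apply, SchwartzMap.smulLeftCLM_apply_apply
      (hχc.hasTemperateGrowth_symbol (hc0 n).ne' 0)]
    simp [θ, symbol, sub_mul]
  rw [(schwartz_withSeminorms ℝ (Eu d) ℂ).tendsto_nhds _ φ]
  rintro ⟨k, l⟩ ε hε
  obtain ⟨k', C, hC0, hC⟩ := hθt.norm_iteratedFDeriv_le_uniform l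
  -- The weight `k + 1 + k'` collects the seminorm's own power, the extra power traded for `c n`,
  -- and the growth of the derivatives of `θ`.
  let S := ((Finset.Iic (k + 1 + k', l)).sup fun m => SchwartzMap.seminorm ℝ m.1 m.2) φ
  let M : ℝ := ∑ i ∈ Finset.range (l + 1), (l.choose i : ℝ) * (C * (2 ^ (k + 1 + k') * S))
  have hS : 0 ≤ S := apply_nonneg _ _
  have hM : 0 ≤ M := Finset.sum_nonneg fun i _ => by positivity
  have key : ∀ n, SchwartzMap.seminorm ℝ k l
      (SchwartzMap.smulLeftCLM ℂ (symbol χ (c n) 0) φ - φ) ≤ c n * M := by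
    intro n
    refine SchwartzMap.seminorm_le_bound ℝ k l _ (mul_nonneg (hc0 n).le hM) fun x => ?_
    rw [hdiff]
    by_cases hx : ‖c n • x‖ < 1
    · have h0 : (fun x => θ (c n • x) * φ x) =ᶠ[𝓝 x] fun _ => 0 := by
        have : ∀ᶠ y in 𝓝 x, ‖c n • y‖ < 1 :=
          (continuous_const_smul (c n)).norm.continuousAt.eventually (gt_mem_nhds hx)
        filter_upwards [this] with y hy
        have : χ (c n • y) = 1 := χ.one_of_mem_closedBall (by simpa using hy.le)
        simp [θ, symbol, this]
      rw [(h0.iteratedFDeriv ℝ l).eq_of_nhds]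
      have : iteratedFDeriv ℝ l (fun _ : Eu d => (0 : ℂ)) x = 0 := by
        simp
      rw [this]
      simpa using mul_nonneg (hc0 n).le hM
    · have hx1 : 1 ≤ c n * ‖x‖ := by
        simpa [norm_smul, abs_of_pos (hc0 n)] using hx
      have h1 := norm_iteratedFDeriv_mul_le (n := l) (N := (⊤ : ℕ∞)) (hθs.comp (contDiff_const_smul (c n)))
        (φ.smooth ⊤) x (by exact_mod_cast le_top)
      simp only [Function.comp_def] at h1
      have h2 : ∀ i ≤ l, ‖iteratedFDeriv ℝ i (fun y => θ (c n • y)) x‖ ≤ C * (1 + ‖x‖) ^ k' := by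
        intro i hi
        rw [iteratedFDeriv_comp_const_smul (c n) (hθs.of_le (by exact_mod_cast le_top)), norm_smul]
        have h3 := hC i hi (c n • x)
        have h4 : ‖c n • x‖ ≤ ‖x‖ := by
          rw [norm_smul, Real.norm_of_nonneg (hc0 n).le]
          exact mul_le_of_le_one_left (norm_nonneg _) (hc1 n)
        calc ‖c n ^ i‖ * ‖iteratedFDeriv ℝ i θ (c n • x)‖
            ≤ 1 * ‖iteratedFDeriv ℝ i θ (c n • x)‖ := by
              gcongr
              rw [norm_pow, Real.norm_of_nonneg (hc0 n).le]
              exact pow_le_one₀ (hc0 n).le (hc1 n)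
          _ ≤ C * (1 + ‖c n • x‖) ^ k' := by rw [one_mul]; exact h3
          _ ≤ _ := by gcongr
      calc ‖x‖ ^ k * ‖iteratedFDeriv ℝ l (fun x => θ (c n • x) * φ x) x‖
          ≤ (c n * ‖x‖) * (‖x‖ ^ k * ∑ i ∈ Finset.range (l + 1), (l.choose i : ℝ) *
              ‖iteratedFDeriv ℝ i (fun y => θ (c n • y)) x‖ * ‖iteratedFDeriv ℝ (l - i) φ x‖) := by
            refine le_trans ?_ (le_mul_of_one_le_left (by positivity) hx1)
            gcongr
        _ = c n * ∑ i ∈ Finset.range (l + 1), (l.choose i : ℝ) * (‖x‖ ^ (k + 1) *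
              ‖iteratedFDeriv ℝ i (fun y => θ (c n • y)) x‖ * ‖iteratedFDeriv ℝ (l - i) φ x‖) := by
            rw [mul_assoc, ← mul_assoc ‖x‖, ← pow_succ', Finset.mul_sum]
            congr 1
            exact Finset.sum_congr rfl fun i _ => by ring
        _ ≤ c n * M := by
            refine mul_le_mul_of_nonneg_left (Finset.sum_le_sum fun i hi => ?_) (hc0 n).le
            have hil : i ≤ l := Nat.lt_succ_iff.1 (Finset.mem_range.1 hi)
            refine mul_le_mul_of_nonneg_left ?_ (Nat.cast_nonneg _)
            calc ‖x‖ ^ (k + 1) * ‖iteratedFDeriv ℝ i (fun y => θ (c n • y)) x‖ *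
                  ‖iteratedFDeriv ℝ (l - i) φ x‖
                ≤ (1 + ‖x‖) ^ (k + 1) * (C * (1 + ‖x‖) ^ k') * ‖iteratedFDeriv ℝ (l - i) φ x‖ := by
                  gcongr
                  · linarith
                  · exact h2 i hil
              _ = C * ((1 + ‖x‖) ^ (k + 1 + k') * ‖iteratedFDeriv ℝ (l - i) φ x‖) := by
                  rw [pow_add]; ring
              _ ≤ C * (2 ^ (k + 1 + k') * S) := by
                  exact mul_le_mul_of_nonneg_left (SchwartzMap.one_add_le_sup_seminorm_apply (𝕜 := ℝ)
                    (m := (k + 1 + k', l)) le_rfl (Nat.sub_le _ _) φ x) hC0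
  have hlim : Tendsto (fun n => c n * M) atTop (𝓝 0) := by
    have := (tendsto_one_div_add_atTop_nhds_zero_nat (𝕜 := ℝ)).mul_const M
    simpa [c] using this
  filter_upwards [hlim.eventually (gt_mem_nhds hε)] with n hn
  exact (key n).trans_lt hn

theorem IsCutoff.fourier_multiplier_apply {χ : Eu d → ℝ} (h : IsCutoff χ) {a : ℝ} (ha : a ≠ 0)
    (c : Eu d) (φ : 𝓢(Eu d, ℂ)) (η : Eu d) :
    𝓕 (SchwartzMap.fourierMultiplierCLM ℂ (symbol χ a c) φ) η = symbol χ a c η * 𝓕 φ η := by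
  rw [SchwartzMap.fourierMultiplierCLM_apply, fourier_fourierInv_eq,
    SchwartzMap.smulLeftCLM_apply_apply (h.hasTemperateGrowth_symbol ha c), smul_eq_mul]

/-- The spectrum of a product of functions with localised spectra. -/
theorem fourierMultiplierCLM_pairing_eq_zero {χ ψ : Eu d → ℝ} (hχ : IsCutoff χ) (hψ : IsCutoff ψ)
    {R : ℝ} (hχR : ∀ ξ, χ ξ ≠ 0 → ‖ξ‖ ≤ R) (hψR : ∀ ξ, ψ ξ ≠ 0 → ‖ξ‖ ≤ R) {a b : ℝ} (ha : 0 < a)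
    (hab : a ≤ b) {c₁ c₂ c₃ : Eu d} (hc : 3 * R < ‖c₃ - (c₁ + (a / b) • c₂)‖)
    (φ₁ φ₂ : 𝓢(Eu d, ℂ)) :
    SchwartzMap.fourierMultiplierCLM ℂ (symbol ψ a c₃)
      (SchwartzMap.pairing (ContinuousLinearMap.mul ℂ ℂ)
        (SchwartzMap.fourierMultiplierCLM ℂ (symbol χ a c₁) φ₁)
        (SchwartzMap.fourierMultiplierCLM ℂ (symbol χ b c₂) φ₂)) = 0 := by
  have hb : 0 < b := ha.trans_le hab
  rw [SchwartzMap.fourierMultiplierCLM_apply]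
  suffices h : SchwartzMap.smulLeftCLM ℂ (symbol ψ a c₃) (𝓕 (SchwartzMap.pairing
      (ContinuousLinearMap.mul ℂ ℂ) (SchwartzMap.fourierMultiplierCLM ℂ (symbol χ a c₁) φ₁)
        (SchwartzMap.fourierMultiplierCLM ℂ (symbol χ b c₂) φ₂))) = 0 by
    rw [h]
    exact map_zero (fourierInvCLM ℂ 𝓢(Eu d, ℂ))
  ext ζ
  rw [SchwartzMap.smulLeftCLM_apply_apply (hψ.hasTemperateGrowth_symbol ha.ne' c₃),
    fourier_pairing_apply]
  simp only [hχ.fourier_multiplier_apply ha.ne', hχ.fourier_multiplier_apply hb.ne']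
  by_cases h3 : ψ (a • ζ - c₃) = 0
  · simp [symbol, h3]
  rw [integral_eq_zero_of_ae, smul_zero]
  · rfl
  refine Eventually.of_forall fun η => ?_
  by_cases h1 : χ (a • -η - c₁) = 0
  · simp only [symbol, h1, Complex.ofReal_zero, zero_mul, Pi.zero_apply]
  by_cases h2 : χ (b • (ζ + η) - c₂) = 0
  · simp only [symbol, h2, Complex.ofReal_zero, zero_mul, mul_zero, Pi.zero_apply]
  exfalso
  have hR : 0 ≤ R := (norm_nonneg _).trans (hψR _ h3)
  -- If all three cutoffs are nonzero, this writes the difference of centres as a combination of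
  -- points of their supports with coefficients at most `1` in modulus (here `a ≤ b` enters). Its
  -- norm is then at most `3 * R`, against `hc`.
  have e : c₃ - (c₁ + (a / b) • c₂) = -(a • ζ - c₃) + ((a • -η - c₁) +
      (a / b) • (b • (ζ + η) - c₂)) := by
    rw [smul_sub, smul_smul, div_mul_cancel₀ _ hb.ne', smul_add, smul_neg]
    abel
  have h4 : ‖(a / b) • (b • (ζ + η) - c₂)‖ ≤ R := by
    rw [norm_smul, Real.norm_of_nonneg (by positivity)]
    calc a / b * ‖b • (ζ + η) - c₂‖ ≤ 1 * R := by
          gcongr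
          · exact (div_le_one hb).2 hab
          · exact hχR _ h2
      _ = R := one_mul R
  have h5 := norm_add_le (-(a • ζ - c₃)) ((a • -η - c₁) + (a / b) • (b • (ζ + η) - c₂))
  have h6 := norm_add_le (a • -η - c₁) ((a / b) • (b • (ζ + η) - c₂))
  rw [← e, norm_neg] at h5
  linarith [hψR _ h3, hχR _ h1]

end Schwartz

section BoundedContinuous

variable {d : ℕ}

/-! ### Bounded continuous functions as tempered distributions -/

theorem memLp_top_boundedContinuousFunction (u : Eu d →ᵇ ℂ) :
    MemLp u ∞ (volume : Measure (Eu d)) :=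
  memLp_top_of_bound u.continuous.aestronglyMeasurable ‖u‖ (ae_of_all _ u.norm_coe_le_norm)

/-- The embedding of bounded continuous functions into `L^∞`. -/
def bcfToLp : (Eu d →ᵇ ℂ) →L[ℂ] Lp ℂ ∞ (volume : Measure (Eu d)) :=
  LinearMap.mkContinuous
    { toFun := fun u => (memLp_top_boundedContinuousFunction u).toLp
      map_add' := fun u v => MemLp.toLp_add (memLp_top_boundedContinuousFunction u)
        (memLp_top_boundedContinuousFunction v)
      map_smul' := fun c u => MemLp.toLp_const_smul c (memLp_top_boundedContinuousFunction u) } 1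
    fun u => by
    change ‖(memLp_top_boundedContinuousFunction u).toLp u‖ ≤ _
    rw [Lp.norm_toLp, one_mul]
    refine ENNReal.toReal_le_of_le_ofReal (norm_nonneg u) ?_
    simpa using eLpNormEssSup_le_of_ae_bound (μ := volume) (ae_of_all _ u.norm_coe_le_norm)

/-- The embedding of bounded continuous functions into tempered distributions. -/
def ofBCF : (Eu d →ᵇ ℂ) →L[ℂ] 𝓢'(Eu d, ℂ) :=
  (Lp.toTemperedDistributionCLM ℂ volume ∞).comp bcfToLp

theorem ofBCF_apply (u : Eu d →ᵇ ℂ) (φ : 𝓢(Eu d, ℂ)) : ofBCF u φ = ∫ x, φ x * u x := by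
  change Lp.toTemperedDistribution (bcfToLp u) φ = _
  rw [Lp.toTemperedDistribution_apply]
  refine integral_congr_ae ?_
  filter_upwards [(memLp_top_boundedContinuousFunction u).coeFn_toLp] with x hx
  change φ x • (memLp_top_boundedContinuousFunction u).toLp u x = _
  rw [hx, smul_eq_mul]

theorem isRepresentedBy_iff {f : 𝓢'(Eu d, ℂ)} {u : Eu d →ᵇ ℂ} :
    IsRepresentedBy f u ↔ ofBCF u = f := by
  constructor
  · intro h
    ext φ
    rw [ofBCF_apply, h φ]
  · rintro rfl φ
    exact ofBCF_apply u φ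

theorem ae_eq_of_forall_schwartz {f g : Eu d → ℂ} (hf : LocallyIntegrable f)
    (hg : LocallyIntegrable g) (h : ∀ φ : 𝓢(Eu d, ℂ), ∫ x, φ x • f x = ∫ x, φ x • g x) :
    f =ᵐ[volume] g := by
  refine ae_eq_of_integral_contDiff_smul_eq hf hg fun θ hθ hc => ?_
  have h1 : HasCompactSupport (Complex.ofRealCLM ∘ θ) := hc.comp_left rfl
  have h2 : ContDiff ℝ (⊤ : ℕ∞) (Complex.ofRealCLM ∘ θ) := Complex.ofRealCLM.contDiff.comp hθ
  simpa using h (h1.toSchwartzMap h2)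

theorem ofBCF_injective : Function.Injective (ofBCF : (Eu d →ᵇ ℂ) → 𝓢'(Eu d, ℂ)) := by
  intro u v h
  have := ae_eq_of_forall_schwartz
    ((memLp_top_boundedContinuousFunction u).locallyIntegrable le_top)
    ((memLp_top_boundedContinuousFunction v).locallyIntegrable le_top) fun φ => by
      simpa only [ofBCF_apply, smul_eq_mul] using congrArg (fun T : 𝓢'(Eu d, ℂ) => T φ) h
  ext x
  exact congrFun ((Continuous.ae_eq_iff_eq volume u.continuous v.continuous).1 this) x

variable {p : ℝ≥0∞} [Fact (1 ≤ p)]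

theorem ae_eq_of_ofBCF_eq {u : Eu d →ᵇ ℂ} {g : Lp ℂ p (volume : Measure (Eu d))}
    (h : Lp.toTemperedDistribution g = ofBCF u) : g =ᵐ[volume] u := by
  refine ae_eq_of_forall_schwartz ((Lp.memLp g).locallyIntegrable Fact.out)
    ((memLp_top_boundedContinuousFunction u).locallyIntegrable le_top) fun φ => ?_
  have := congrArg (fun T : 𝓢'(Eu d, ℂ) => T φ) h
  simpa only [ofBCF_apply, Lp.toTemperedDistribution_apply, smul_eq_mul] using this

theorem ofBCF_toBoundedContinuousFunction (φ : 𝓢(Eu d, ℂ)) :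
    ofBCF φ.toBoundedContinuousFunction = SchwartzMap.toTemperedDistributionCLM (Eu d) ℂ volume φ := by
  ext θ
  rw [ofBCF_apply]
  exact (SchwartzMap.toTemperedDistributionCLM_apply_apply volume φ θ).symm

/-! ### The `L^p` norm of a distribution -/

theorem distLpNorm_toTemperedDistribution (g : Lp ℂ p (volume : Measure (Eu d))) :
    distLpNorm p (Lp.toTemperedDistribution g) = ‖g‖ₑ := by
  refine le_antisymm (iInf₂_le (f := fun (g' : Lp ℂ p (volume : Measure (Eu d)))
    (_ : Lp.toTemperedDistribution g' = Lp.toTemperedDistribution g) => ‖g'‖ₑ) g rfl)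
    (le_iInf₂ fun g' hg' => ?_)
  have h := LinearMap.ker_eq_bot.1
    (Lp.ker_toTemperedDistributionCLM_eq_bot (F := ℂ) (μ := (volume : Measure (Eu d))) (p := p))
  rw [h hg']

theorem exists_of_distLpNorm_ne_top {f : 𝓢'(Eu d, ℂ)} (h : distLpNorm p f ≠ ∞) :
    ∃ g : Lp ℂ p (volume : Measure (Eu d)), Lp.toTemperedDistribution g = f ∧
      ‖g‖ₑ = distLpNorm p f := by
  by_contra hne
  push Not at hne
  refine h ?_
  simp only [distLpNorm, iInf_eq_top]
  intro g hg
  exact absurd (by rw [← hg, distLpNorm_toTemperedDistribution]) (hne g hg)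

theorem summable_norm_of_tsum_enorm_ne_top {ι E : Type*} [NormedAddCommGroup E] {g : ι → E}
    (h : ∑' i, ‖g i‖ₑ ≠ ∞) : Summable fun i => ‖g i‖ := by
  have : Summable fun i => ‖g i‖₊ := by
    rw [← ENNReal.tsum_coe_ne_top_iff_summable]
    exact h
  simpa using NNReal.summable_coe.2 this

theorem enorm_tsum_le {ι E : Type*} [NormedAddCommGroup E] (g : ι → E) :
    ‖∑' i, g i‖ₑ ≤ ∑' i, ‖g i‖ₑ := by
  by_cases h : ∑' i, ‖g i‖ₑ = ∞
  · rw [h]; exact le_top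
  have h1 := summable_norm_of_tsum_enorm_ne_top h
  have h2 : Summable fun i => ‖g i‖₊ := by
    rw [← ENNReal.tsum_coe_ne_top_iff_summable]; exact h
  simp only [enorm_eq_nnnorm]
  rw [← ENNReal.coe_tsum h2, ENNReal.coe_le_coe]
  exact nnnorm_tsum_le h2

/-- When the right side is finite, the representatives converge absolutely in `L^p`; by continuity
of the embedding into distributions their sum represents `f`. -/
theorem distLpNorm_le_tsum {ι : Type*} {F : ι → 𝓢'(Eu d, ℂ)} {f : 𝓢'(Eu d, ℂ)} (h : HasSum F f) :
    distLpNorm p f ≤ ∑' i, distLpNorm p (F i) := by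
  by_cases htop : ∑' i, distLpNorm p (F i) = ∞
  · rw [htop]; exact le_top
  choose g hg hgn using fun i => exists_of_distLpNorm_ne_top (ENNReal.ne_top_of_tsum_ne_top htop i)
  have hs : Summable g := by
    refine Summable.of_norm (summable_norm_of_tsum_enorm_ne_top ?_)
    simpa only [hgn] using htop
  have h1 : HasSum F (Lp.toTemperedDistribution (∑' i, g i)) := by
    have := hs.hasSum.map (Lp.toTemperedDistributionCLM ℂ (volume : Measure (Eu d)) p)
      (Lp.toTemperedDistributionCLM ℂ (volume : Measure (Eu d)) p).continuous
    simpa only [Function.comp_def, Lp.toTemperedDistributionCLM_apply, hg] using this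
  rw [h.unique h1, distLpNorm_toTemperedDistribution]
  simpa only [hgn] using enorm_tsum_le g

theorem distLpNorm_zero : distLpNorm p (0 : 𝓢'(Eu d, ℂ)) = 0 := by
  have := distLpNorm_toTemperedDistribution (0 : Lp ℂ p (volume : Measure (Eu d)))
  rw [← Lp.toTemperedDistributionCLM_apply, map_zero] at this
  simpa using this

theorem distLpNorm_smul_le (c : ℂ) (f : 𝓢'(Eu d, ℂ)) :
    distLpNorm p (c • f) ≤ ‖c‖ₑ * distLpNorm p f := by
  by_cases htop : distLpNorm p f = ∞
  · by_cases hc : c = 0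
    · rw [hc, show (0 : ℂ) • f = 0 from zero_smul ℂ f, distLpNorm_zero]; exact zero_le
    · rw [htop, ENNReal.mul_top (by simpa using hc)]; exact le_top
  obtain ⟨g, hg, hgn⟩ := exists_of_distLpNorm_ne_top htop
  rw [← hgn, ← hg, ← Lp.toTemperedDistributionCLM_apply, ← map_smul,
    Lp.toTemperedDistributionCLM_apply, distLpNorm_toTemperedDistribution, enorm_smul]

theorem distLpNorm_ofBCF_mul_le (u v : Eu d →ᵇ ℂ) :
    distLpNorm p (ofBCF (u * v)) ≤ distLpNorm p (ofBCF u) * ‖v‖ₑ := by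
  by_cases hv : v = 0
  · rw [hv, mul_zero, map_zero, distLpNorm_zero]; exact zero_le
  by_cases htop : distLpNorm p (ofBCF u) = ∞
  · rw [htop, ENNReal.top_mul (by simpa using hv)]; exact le_top
  obtain ⟨g, hg, hgn⟩ := exists_of_distLpNorm_ne_top htop
  have hgu := ae_eq_of_ofBCF_eq hg
  have hb : ∀ᵐ x : Eu d, ‖(u * v) x‖ ≤ ‖v‖ * ‖g x‖ := by
    filter_upwards [hgu] with x hx
    rw [hx, BoundedContinuousFunction.mul_apply, norm_mul, mul_comm]
    gcongr
    exact v.norm_coe_le_norm x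
  have hm : MemLp (u * v) p (volume : Measure (Eu d)) :=
    (Lp.memLp g).of_le_mul (u * v).continuous.aestronglyMeasurable hb
  have h1 : Lp.toTemperedDistribution (hm.toLp _) = ofBCF (u * v) := by
    ext φ
    rw [ofBCF_apply, Lp.toTemperedDistribution_apply]
    refine integral_congr_ae ?_
    filter_upwards [hm.coeFn_toLp] with x hx
    rw [hx]; rfl
  rw [← h1, distLpNorm_toTemperedDistribution, ← hgn, Lp.enorm_def, Lp.enorm_def,
    eLpNorm_congr_ae hm.coeFn_toLp, ← ofReal_norm v]
  rw [mul_comm (eLpNorm _ _ _)]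
  exact eLpNorm_le_mul_eLpNorm_of_ae_le_mul hb p

end BoundedContinuous

section Multiplier

/-! ### Fourier multipliers on `L^p` -/

variable {d : ℕ} (p : ℝ≥0∞) [Fact (1 ≤ p)]

/-- The extension to `L^p` of a Fourier multiplier on Schwartz functions. -/
def lpMultiplier (m : Eu d → ℂ) :
    Lp ℂ p (volume : Measure (Eu d)) →L[ℂ] Lp ℂ p (volume : Measure (Eu d)) :=
  ((SchwartzMap.toLpCLM ℂ ℂ p volume).toLinearMap ∘ₗ
    (SchwartzMap.fourierMultiplierCLM ℂ m).toLinearMap).extendOfNorm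
      (SchwartzMap.toLpCLM ℂ ℂ p volume).toLinearMap

/-- The extension of a Fourier multiplier on Schwartz functions to a map from `L^p` to bounded
continuous functions. -/
def bcfMultiplier (m : Eu d → ℂ) : Lp ℂ p (volume : Measure (Eu d)) →L[ℂ] (Eu d →ᵇ ℂ) :=
  ((SchwartzMap.toBoundedContinuousFunctionCLM ℂ (Eu d) ℂ).toLinearMap ∘ₗ
    (SchwartzMap.fourierMultiplierCLM ℂ m).toLinearMap).extendOfNorm
      (SchwartzMap.toLpCLM ℂ ℂ p volume).toLinearMap

variable {p}

theorem IsCutoff.exists_schwartz_bound (hp : p ≠ ∞) {χ : Eu d → ℝ} (h : IsCutoff χ) :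
    ∃ A : ℝ≥0, ∀ a : ℝ, 0 < a → ∀ (c : Eu d) (φ : 𝓢(Eu d, ℂ)),
      ‖(SchwartzMap.fourierMultiplierCLM ℂ (symbol χ a c) φ).toLp p‖ ≤ A * ‖φ.toLp p‖ ∧
      ‖(SchwartzMap.fourierMultiplierCLM ℂ (symbol χ a c) φ).toBoundedContinuousFunction‖ ≤
        A * ((a ^ d)⁻¹) ^ (p⁻¹).toReal * ‖φ.toLp p‖ := by
  have hp1 : 1 ≤ p := Fact.out
  obtain ⟨A, hA⟩ := h.exists_kernel_bound
  refine ⟨A, fun a ha c φ => ?_⟩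
  obtain ⟨h1, h2⟩ := hA a ha c
  have hfin : eLpNorm φ p volume ≠ ∞ := (φ.eLpNorm_lt_top p volume).ne
  rw [h.fourierMultiplierCLM_eq_conv ha.ne', SchwartzMap.norm_toLp, SchwartzMap.norm_toLp]
  constructor
  · have := ENNReal.toReal_mono (by finiteness) (eLpNorm_conv_le (h.kernel ha.ne' c) φ hp1 hp h1)
    simpa using this
  · refine (BoundedContinuousFunction.norm_le (by positivity)).2 fun x => ?_
    have := ENNReal.toReal_mono (by finiteness) (enorm_conv_le (h.kernel ha.ne' c) φ hp1 hp h1 h2 x)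
    rw [ENNReal.toReal_mul, ENNReal.toReal_mul, ← ENNReal.toReal_rpow,
      ENNReal.toReal_ofReal (by positivity), toReal_enorm] at this
    simpa using this

theorem denseRange_toLp (hp : p ≠ ∞) :
    DenseRange (SchwartzMap.toLpCLM ℂ ℂ p (volume : Measure (Eu d))).toLinearMap :=
  SchwartzMap.denseRange_toLpCLM (F := ℂ) hp

variable {χ : Eu d → ℝ} {a : ℝ}

theorem IsCutoff.lpMultiplier_toLp (h : IsCutoff χ) (hp : p ≠ ∞) (ha : 0 < a) (c : Eu d)
    (φ : 𝓢(Eu d, ℂ)) : lpMultiplier p (symbol χ a c) (φ.toLp p) =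
      (SchwartzMap.fourierMultiplierCLM ℂ (symbol χ a c) φ).toLp p := by
  obtain ⟨A, hA⟩ := h.exists_schwartz_bound hp
  exact LinearMap.extendOfNorm_eq (denseRange_toLp hp) ⟨A, fun φ => (hA a ha c φ).1⟩ φ

theorem IsCutoff.bcfMultiplier_toLp (h : IsCutoff χ) (hp : p ≠ ∞) (ha : 0 < a) (c : Eu d)
    (φ : 𝓢(Eu d, ℂ)) : bcfMultiplier p (symbol χ a c) (φ.toLp p) =
      (SchwartzMap.fourierMultiplierCLM ℂ (symbol χ a c) φ).toBoundedContinuousFunction := by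
  obtain ⟨A, hA⟩ := h.exists_schwartz_bound hp
  exact LinearMap.extendOfNorm_eq (denseRange_toLp hp) ⟨_, fun φ => (hA a ha c φ).2⟩ φ

theorem IsCutoff.exists_multiplier_bound (hp : p ≠ ∞) (h : IsCutoff χ) :
    ∃ A : ℝ≥0, ∀ a : ℝ, 0 < a → ∀ (c : Eu d) (g : Lp ℂ p (volume : Measure (Eu d))),
      ‖lpMultiplier p (symbol χ a c) g‖ ≤ A * ‖g‖ ∧
      ‖bcfMultiplier p (symbol χ a c) g‖ ≤ A * ((a ^ d)⁻¹) ^ (p⁻¹).toReal * ‖g‖ := by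
  obtain ⟨A, hA⟩ := h.exists_schwartz_bound hp
  exact ⟨A, fun a ha c g =>
    ⟨LinearMap.norm_extendOfNorm_apply_le (denseRange_toLp hp) _ (fun φ => (hA a ha c φ).1) g,
      LinearMap.norm_extendOfNorm_apply_le (denseRange_toLp hp) _ (fun φ => (hA a ha c φ).2) g⟩⟩

/-- Continuous linear maps on `L^p` are determined by their values on Schwartz functions. -/
theorem clm_eq_of_schwartz (hp : p ≠ ∞)
    {S T : Lp ℂ p (volume : Measure (Eu d)) →L[ℂ] 𝓢'(Eu d, ℂ)}
    (h : ∀ φ : 𝓢(Eu d, ℂ), S (φ.toLp p) = T (φ.toLp p)) : S = T := by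
  have := (denseRange_toLp (d := d) hp).equalizer S.continuous T.continuous (funext h)
  exact DFunLike.coe_injective this

/-- Both sides are continuous in `g` and agree on Schwartz functions, which are dense because `p` is
finite. -/
theorem IsCutoff.toTemperedDistribution_lpMultiplier (h : IsCutoff χ) (hp : p ≠ ∞) (ha : 0 < a)
    (c : Eu d) (g : Lp ℂ p (volume : Measure (Eu d))) :
    Lp.toTemperedDistribution (lpMultiplier p (symbol χ a c) g) =
      TemperedDistribution.fourierMultiplierCLM ℂ (symbol χ a c) (Lp.toTemperedDistribution g) := by
  have key : (Lp.toTemperedDistributionCLM ℂ volume p).comp (lpMultiplier p (symbol χ a c)) =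
      (TemperedDistribution.fourierMultiplierCLM ℂ (symbol χ a c)).comp
        (Lp.toTemperedDistributionCLM ℂ volume p) := by
    refine clm_eq_of_schwartz hp fun φ => ?_
    rw [ContinuousLinearMap.comp_apply, ContinuousLinearMap.comp_apply,
      Lp.toTemperedDistributionCLM_apply, Lp.toTemperedDistributionCLM_apply]
    rw [h.lpMultiplier_toLp hp ha, Lp.toTemperedDistribution_toLp_eq,
      Lp.toTemperedDistribution_toLp_eq]
    exact (TemperedDistribution.fourierMultiplierCLM_toTemperedDistributionCLM_eq
      (h.hasTemperateGrowth_symbol ha.ne' c) φ).symm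
  exact DFunLike.congr_fun key g

theorem IsCutoff.ofBCF_bcfMultiplier (h : IsCutoff χ) (hp : p ≠ ∞) (ha : 0 < a)
    (c : Eu d) (g : Lp ℂ p (volume : Measure (Eu d))) :
    ofBCF (bcfMultiplier p (symbol χ a c) g) =
      TemperedDistribution.fourierMultiplierCLM ℂ (symbol χ a c) (Lp.toTemperedDistribution g) := by
  have key : ofBCF.comp (bcfMultiplier p (symbol χ a c)) =
      (TemperedDistribution.fourierMultiplierCLM ℂ (symbol χ a c)).comp
        (Lp.toTemperedDistributionCLM ℂ volume p) := by
    refine clm_eq_of_schwartz hp fun φ => ?_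
    rw [ContinuousLinearMap.comp_apply, ContinuousLinearMap.comp_apply,
      Lp.toTemperedDistributionCLM_apply]
    rw [h.bcfMultiplier_toLp hp ha, Lp.toTemperedDistribution_toLp_eq,
      ofBCF_toBoundedContinuousFunction]
    exact (TemperedDistribution.fourierMultiplierCLM_toTemperedDistributionCLM_eq
      (h.hasTemperateGrowth_symbol ha.ne' c) φ).symm
  exact DFunLike.congr_fun key g

/-- A product of functions with localised spectra has a localised spectrum. -/
theorem fourierMultiplierCLM_mul_eq_zero (hp : p ≠ ∞) {ψ : Eu d → ℝ} (hχ : IsCutoff χ)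
    (hψ : IsCutoff ψ) {R : ℝ} (hχR : ∀ ξ, χ ξ ≠ 0 → ‖ξ‖ ≤ R) (hψR : ∀ ξ, ψ ξ ≠ 0 → ‖ξ‖ ≤ R) {b : ℝ}
    (ha : 0 < a) (hab : a ≤ b) {c₁ c₂ c₃ : Eu d} (hc : 3 * R < ‖c₃ - (c₁ + (a / b) • c₂)‖)
    (g₁ g₂ : Lp ℂ p (volume : Measure (Eu d))) :
    TemperedDistribution.fourierMultiplierCLM ℂ (symbol ψ a c₃)
      (ofBCF (bcfMultiplier p (symbol χ a c₁) g₁ * bcfMultiplier p (symbol χ b c₂) g₂)) = 0 := by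
  -- Joint continuity of the product in the sup norm lets the vanishing pass from pairs of Schwartz
  -- functions to all pairs by density.
  have h1 : Continuous fun q : Lp ℂ p (volume : Measure (Eu d)) × Lp ℂ p (volume : Measure (Eu d)) =>
      bcfMultiplier p (symbol χ a c₁) q.1 * bcfMultiplier p (symbol χ b c₂) q.2 :=
    ((bcfMultiplier p (symbol χ a c₁)).continuous.comp continuous_fst).mul
      ((bcfMultiplier p (symbol χ b c₂)).continuous.comp continuous_snd)
  have h2 : Continuous fun q : Lp ℂ p (volume : Measure (Eu d)) × Lp ℂ p (volume : Measure (Eu d)) =>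
      ((TemperedDistribution.fourierMultiplierCLM ℂ (symbol ψ a c₃)).comp ofBCF)
        (bcfMultiplier p (symbol χ a c₁) q.1 * bcfMultiplier p (symbol χ b c₂) q.2) :=
    ((TemperedDistribution.fourierMultiplierCLM ℂ (symbol ψ a c₃)).comp ofBCF).continuous.comp h1
  have h3 := (isClosed_singleton (x := (0 : 𝓢'(Eu d, ℂ)))).preimage h2
  refine (denseRange_toLp hp).induction_on₂
    (p := fun g₁ g₂ => TemperedDistribution.fourierMultiplierCLM ℂ (symbol ψ a c₃)
      (ofBCF (bcfMultiplier p (symbol χ a c₁) g₁ * bcfMultiplier p (symbol χ b c₂) g₂)) = 0)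
    h3 (fun φ₁ φ₂ => ?_) g₁ g₂
  · simp only [ContinuousLinearMap.coe_coe, SchwartzMap.toLpCLM_apply]
    rw [hχ.bcfMultiplier_toLp hp ha, hχ.bcfMultiplier_toLp hp (ha.trans_le hab)]
    have e : (SchwartzMap.fourierMultiplierCLM ℂ (symbol χ a c₁) φ₁).toBoundedContinuousFunction *
        (SchwartzMap.fourierMultiplierCLM ℂ (symbol χ b c₂) φ₂).toBoundedContinuousFunction =
        (SchwartzMap.pairing (ContinuousLinearMap.mul ℂ ℂ)
          (SchwartzMap.fourierMultiplierCLM ℂ (symbol χ a c₁) φ₁)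
          (SchwartzMap.fourierMultiplierCLM ℂ (symbol χ b c₂) φ₂)).toBoundedContinuousFunction := by
      ext x
      rfl
    rw [e, ofBCF_toBoundedContinuousFunction]
    refine (TemperedDistribution.fourierMultiplierCLM_toTemperedDistributionCLM_eq
      (hψ.hasTemperateGrowth_symbol ha.ne' c₃) _).trans ?_
    rw [fourierMultiplierCLM_pairing_eq_zero hχ hψ hχR hψR ha hab hc]
    exact map_zero _

end Multiplier

section Window

variable {d : ℕ}

/-! ### Windows and lattice points -/

/-- The dilation factor of the scale `j`. -/
def scaleFactor (j : ℤ) : ℝ := (2 : ℝ) ^ (-j) * (2 * Real.pi)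

theorem scaleFactor_pos (j : ℤ) : 0 < scaleFactor j := by
  have := Real.pi_pos
  unfold scaleFactor
  positivity

theorem scaleFactor_le {l j : ℤ} (h : l ≤ j) : scaleFactor j ≤ scaleFactor l := by
  have := Real.pi_pos
  unfold scaleFactor
  gcongr
  exact one_le_two

theorem box_eq (ψ : Eu d → ℝ) (j : ℤ) (k : Fin d → ℤ) (f : 𝓢'(Eu d, ℂ)) :
    box ψ j k f = TemperedDistribution.fourierMultiplierCLM ℂ
      (symbol ψ (scaleFactor j) (latticePoint k)) f := by
  simp only [box, smul_smul, scaleFactor]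
  rfl

/-- A radius containing the support of every window. -/
def windowRadius (d : ℕ) : ℝ := √(∑ _i : Fin d, (3 / 4 : ℝ) ^ 2)

theorem IsWindow.norm_le {ψ : Eu d → ℝ} (h : IsWindow ψ) {ξ : Eu d} (hξ : ψ ξ ≠ 0) :
    ‖ξ‖ ≤ windowRadius d := by
  rw [EuclideanSpace.norm_eq]
  refine Real.sqrt_le_sqrt (Finset.sum_le_sum fun i _ => ?_)
  have : |ξ i| ≤ 3 / 4 := by
    by_contra hi
    exact hξ (h.support ξ ⟨i, not_le.1 hi⟩)
  rw [Real.norm_eq_abs]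
  gcongr

theorem IsWindow.isCutoff {ψ : Eu d → ℝ} (h : IsWindow ψ) : IsCutoff ψ := by
  refine ⟨h.smooth, HasCompactSupport.intro (isCompact_closedBall (0 : Eu d) (windowRadius d))
    fun ξ hξ => ?_⟩
  by_contra h0
  exact hξ (by simpa using h.norm_le h0)

theorem windowRadius_nonneg (d : ℕ) : 0 ≤ windowRadius d := Real.sqrt_nonneg _

/-- A cutoff function that is `1` on the support of every window. -/
def wideCutoff (d : ℕ) : Eu d → ℝ :=
  (⟨windowRadius d + 1, windowRadius d + 2, by linarith [windowRadius_nonneg d], by linarith⟩ :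
    ContDiffBump (0 : Eu d))

theorem isCutoff_wideCutoff (d : ℕ) : IsCutoff (wideCutoff d) :=
  ⟨ContDiffBump.contDiff _, ContDiffBump.hasCompactSupport _⟩

theorem norm_le_of_wideCutoff_ne_zero {ξ : Eu d} (h : wideCutoff d ξ ≠ 0) :
    ‖ξ‖ ≤ windowRadius d + 2 := by
  by_contra hξ
  refine h (ContDiffBump.zero_of_le_dist _ ?_)
  simpa using (not_le.1 hξ).le

theorem IsWindow.wideCutoff_mul {ψ : Eu d → ℝ} (h : IsWindow ψ) (ξ : Eu d) :
    wideCutoff d ξ * ψ ξ = ψ ξ := by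
  by_cases hξ : ψ ξ = 0
  · simp [hξ]
  have : wideCutoff d ξ = 1 := by
    refine ContDiffBump.one_of_mem_closedBall _ ?_
    have := h.norm_le hξ
    simp only [mem_closedBall_zero_iff]
    linarith
  rw [this, one_mul]

/-- An interval of length `2ρ` contains at most `⌊2ρ⌋ + 1` integers wherever it lies. The
independence of `c` is what later bounds the number of boxes meeting the spectrum of a product. -/
theorem exists_finset_lattice (d : ℕ) (ρ : ℝ) : ∃ N : ℕ, ∀ c : Eu d, ∃ S : Finset (Fin d → ℤ),
    S.card ≤ N ∧ ∀ k, ‖latticePoint k - c‖ ≤ ρ → k ∈ S := by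
  refine ⟨(⌊2 * ρ⌋ + 1).toNat ^ d, fun c =>
    ⟨Fintype.piFinset fun i => Finset.Icc ⌈c i - ρ⌉ ⌊c i + ρ⌋, ?_, fun k hk => ?_⟩⟩
  · rw [Fintype.card_piFinset]
    simp only [Int.card_Icc]
    refine (Finset.prod_le_prod' (g := fun _ => (⌊2 * ρ⌋ + 1).toNat) fun i _ => ?_).trans (by simp)
    refine Int.toNat_le_toNat ?_
    have h1 : ⌊c i + ρ⌋ - ⌈c i - ρ⌉ ≤ ⌊2 * ρ⌋ := by
      rw [Int.le_floor]
      push_cast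
      linarith [Int.floor_le (c i + ρ), Int.le_ceil (c i - ρ)]
    linarith
  · rw [Fintype.mem_piFinset]
    intro i
    have h1 := (PiLp.norm_apply_le (latticePoint k - c) i).trans hk
    have h2 : (latticePoint k - c) i = (k i : ℝ) - c i := rfl
    rw [h2, Real.norm_eq_abs, abs_le] at h1
    rw [Finset.mem_Icc, Int.ceil_le, Int.le_floor]
    constructor <;> linarith

/-! ### Synthesis -/

/-- Only finitely many windows meet the compact support of `θ`, so the partition of unity acts as a
finite sum and no convergence in the Schwartz topology is at stake. -/
theorem IsWindow.hasSum_box_apply {ψ : Eu d → ℝ} (h : IsWindow ψ) (j : ℤ) (f : 𝓢'(Eu d, ℂ))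
    {θ : 𝓢(Eu d, ℂ)} (hθ : HasCompactSupport θ) :
    HasSum (fun k => box ψ j k f (𝓕 θ)) (f (𝓕 θ)) := by
  have ha := scaleFactor_pos j
  set a := scaleFactor j
  obtain ⟨ρ, hρ⟩ := hθ.isCompact.isBounded.exists_norm_le
  obtain ⟨N, hN⟩ := exists_finset_lattice d (a * ρ + windowRadius d)
  obtain ⟨S, -, hS⟩ := hN 0
  have hfar : ∀ k ∉ S, ∀ η : Eu d, θ η ≠ 0 → ψ (a • η - latticePoint k) = 0 := by
    intro k hk η hη
    by_contra h0
    refine hk (hS k ?_)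
    have h1 := h.norm_le h0
    have h2 := hρ η (subset_tsupport _ hη)
    have h3 : latticePoint k - (0 : Eu d) = a • η - (a • η - latticePoint k) := by
      rw [sub_zero, sub_sub_cancel]
    rw [h3]
    refine (norm_sub_le _ _).trans ?_
    rw [norm_smul, Real.norm_of_nonneg ha.le]
    gcongr
  have hb : ∀ k, box ψ j k f (𝓕 θ) =
      f (𝓕 (SchwartzMap.smulLeftCLM ℂ (symbol ψ a (latticePoint k)) θ)) := by
    intro k
    have e : 𝓕⁻ (𝓕 θ : 𝓢(Eu d, ℂ)) = θ := fourierInv_fourier_eq θ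
    rw [box_eq, TemperedDistribution.fourierMultiplierCLM_apply_apply, e]
  have htg := fun k : Fin d → ℤ => h.isCutoff.hasTemperateGrowth_symbol ha.ne' (latticePoint k)
  have h0 : ∀ k ∉ S, box ψ j k f (𝓕 θ) = 0 := by
    intro k hk
    have : SchwartzMap.smulLeftCLM ℂ (symbol ψ a (latticePoint k)) θ = 0 := by
      ext η
      rw [SchwartzMap.smulLeftCLM_apply_apply (htg k)]
      by_cases hη : θ η = 0
      · rw [hη, smul_zero]; rfl
      · rw [symbol, hfar k hk η hη, Complex.ofReal_zero, zero_smul]; rfl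
    rw [hb, this]
    have e : 𝓕 (0 : 𝓢(Eu d, ℂ)) = 0 := map_zero (fourierCLM ℂ 𝓢(Eu d, ℂ))
    rw [e, map_zero]
  have h1 : ∑ k ∈ S, SchwartzMap.smulLeftCLM ℂ (symbol ψ a (latticePoint k)) θ = θ := by
    ext η
    have e1 : (∑ k ∈ S, SchwartzMap.smulLeftCLM ℂ (symbol ψ a (latticePoint k)) θ) η =
        ∑ k ∈ S, symbol ψ a (latticePoint k) η * θ η := by
      rw [sum_apply]
      exact Finset.sum_congr rfl fun k _ => by
        rw [SchwartzMap.smulLeftCLM_apply_apply (htg k), smul_eq_mul]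
    rw [e1, ← Finset.sum_mul]
    by_cases hη : θ η = 0
    · rw [hη, mul_zero]
    have e2 := (h.partition (a • η)).unique
      (hasSum_sum_of_ne_finset_zero (L := SummationFilter.unconditional _)
      fun k hk => hfar k hk η hη)
    have e3 : ∑ k ∈ S, symbol ψ a (latticePoint k) η = 1 := by
      simp only [symbol, ← Complex.ofReal_sum, ← e2, Complex.ofReal_one]
    rw [e3, one_mul]
  have h2 := hasSum_sum_of_ne_finset_zero (L := SummationFilter.unconditional _) h0
  have h3 : ∑ k ∈ S, box ψ j k f (𝓕 θ) = f (𝓕 θ) := by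
    simp only [hb]
    have e : 𝓕 θ = ∑ k ∈ S, 𝓕 (SchwartzMap.smulLeftCLM ℂ (symbol ψ a (latticePoint k)) θ) := by
      conv_lhs => rw [← h1]
      exact map_sum (fourierCLM ℂ 𝓢(Eu d, ℂ)) _ S
    rw [e, map_sum]
  rwa [h3] at h2

/-- The two distributions agree on `𝓕 θ` for compactly supported `θ`, and such test functions are
dense by truncation on the frequency side. -/
theorem IsWindow.ofBCF_eq_of_hasSum {ψ : Eu d → ℝ} (h : IsWindow ψ) {j : ℤ} {f : 𝓢'(Eu d, ℂ)}
    {w : (Fin d → ℤ) → Eu d →ᵇ ℂ} {u : Eu d →ᵇ ℂ} (hw : ∀ k, ofBCF (w k) = box ψ j k f)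
    (hu : HasSum w u) : ofBCF u = f := by
  have hc : ∀ θ : 𝓢(Eu d, ℂ), HasCompactSupport θ → ofBCF u (𝓕 θ) = f (𝓕 θ) := by
    intro θ hθ
    have h1 := (hu.map ofBCF ofBCF.continuous).map (PointwiseConvergenceCLM.evalCLM _ ℂ (𝓕 θ))
      (PointwiseConvergenceCLM.evalCLM _ ℂ (𝓕 θ)).continuous
    refine h1.unique ?_
    have e : (fun k => box ψ j k f (𝓕 θ)) =
        PointwiseConvergenceCLM.evalCLM (RingHom.id ℂ) ℂ (𝓕 θ) ∘ ofBCF ∘ w := by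
      ext k
      simp only [Function.comp_apply, hw]
      rfl
    rw [← e]
    exact h.hasSum_box_apply j f hθ
  ext φ
  obtain ⟨θ, hθc, hθ⟩ := exists_tendsto_hasCompactSupport (𝓕⁻ φ)
  have hF : Tendsto (fun n => 𝓕 (θ n)) atTop (𝓝 φ) := by
    have := ((fourierCLM ℂ 𝓢(Eu d, ℂ)).continuous.tendsto (𝓕⁻ φ)).comp hθ
    have e : 𝓕 (𝓕⁻ φ : 𝓢(Eu d, ℂ)) = φ := fourier_fourierInv_eq φ
    rw [fourierCLM_apply, e] at this
    exact this
  refine tendsto_nhds_unique (((ofBCF u).continuous.tendsto φ).comp hF) ?_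
  have := (f.continuous.tendsto φ).comp hF
  refine this.congr fun n => ?_
  exact (hc (θ n) (hθc n)).symm

end Window

section ModulationNorm

variable {d : ℕ} {p : ℝ≥0∞} [Fact (1 ≤ p)] {ψ : Eu d → ℝ}

/-! ### The modulation norms -/

theorem ellNorm_one {ι : Type*} (a : ι → ℝ≥0∞) : ellNorm 1 a = ∑' i, a i := by
  simp [ellNorm]

theorem modNorm_one (j : ℤ) (f : 𝓢'(Eu d, ℂ)) :
    modNorm ψ p 1 j f = ∑' k, distLpNorm p (box ψ j k f) := ellNorm_one _

theorem box_hasSum {ι : Type*} {F : ι → 𝓢'(Eu d, ℂ)} {f : 𝓢'(Eu d, ℂ)} (h : HasSum F f) (j : ℤ)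
    (k : Fin d → ℤ) : HasSum (fun i => box ψ j k (F i)) (box ψ j k f) :=
  h.map (TemperedDistribution.fourierMultiplierCLM ℂ _)
    (TemperedDistribution.fourierMultiplierCLM ℂ _).continuous

theorem modNorm_le_tsum {ι : Type*} {F : ι → 𝓢'(Eu d, ℂ)} {f : 𝓢'(Eu d, ℂ)} (h : HasSum F f)
    (j : ℤ) : modNorm ψ p 1 j f ≤ ∑' i, modNorm ψ p 1 j (F i) := by
  simp only [modNorm_one]
  rw [ENNReal.tsum_comm]
  exact ENNReal.tsum_le_tsum fun k => distLpNorm_le_tsum (box_hasSum h j k)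

theorem modNorm_smul_le (c : ℂ) (j : ℤ) (f : 𝓢'(Eu d, ℂ)) :
    modNorm ψ p 1 j (c • f) ≤ ‖c‖ₑ * modNorm ψ p 1 j f := by
  simp only [modNorm_one]
  rw [← ENNReal.tsum_mul_left]
  refine ENNReal.tsum_le_tsum fun k => ?_
  rw [show box ψ j k (c • f) = c • box ψ j k f from map_smul _ c f]
  exact distLpNorm_smul_le c _

theorem modNorm_zero (j : ℤ) : modNorm ψ p 1 j (0 : 𝓢'(Eu d, ℂ)) = 0 := by
  have h (k : Fin d → ℤ) : box ψ j k (0 : 𝓢'(Eu d, ℂ)) = 0 := map_zero _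
  simp [modNorm_one, h, distLpNorm_zero]

theorem IsCutoff.exists_distLpNorm_box_le (hp : p ≠ ∞) (h : IsCutoff ψ) :
    ∃ A : ℝ≥0, ∀ (j : ℤ) (k : Fin d → ℤ) (f : 𝓢'(Eu d, ℂ)),
      distLpNorm p (box ψ j k f) ≤ A * distLpNorm p f := by
  obtain ⟨A, hA⟩ := h.exists_multiplier_bound hp
  -- A nonzero constant, so that the bound also holds when `distLpNorm p f = ∞`.
  refine ⟨A + 1, fun j k f => ?_⟩
  by_cases htop : distLpNorm p f = ∞
  · rw [htop, ENNReal.mul_top (by simp)]; exact le_top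
  obtain ⟨g, rfl, hg⟩ := exists_of_distLpNorm_ne_top htop
  rw [box_eq, ← h.toTemperedDistribution_lpMultiplier hp (scaleFactor_pos j),
    distLpNorm_toTemperedDistribution, ← hg]
  have h1 := (hA _ (scaleFactor_pos j) (latticePoint k) g).1
  have h2 := ENNReal.ofReal_le_ofReal h1
  rw [ENNReal.ofReal_mul A.coe_nonneg, ofReal_norm, ofReal_norm, ENNReal.ofReal_coe_nnreal] at h2
  refine h2.trans ?_
  gcongr
  simp

/-- The inverse dilation factor is `2^j / (2π) ≤ 2^j`; this converts the Bernstein constant into the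
weight `2^{jd/p}`. -/
theorem scaleFactor_rpow_le (p : ℝ≥0∞) (j : ℤ) :
    ENNReal.ofReal (((scaleFactor j ^ d)⁻¹) ^ (p⁻¹).toReal) ≤
      (2 : ℝ≥0∞) ^ ((j : ℝ) * (d * (p⁻¹).toReal)) := by
  have h0 := scaleFactor_pos j
  have h1 : (scaleFactor j)⁻¹ ≤ (2 : ℝ) ^ (j : ℝ) := by
    rw [Real.rpow_intCast, scaleFactor, mul_inv, zpow_neg, inv_inv]
    refine mul_le_of_le_one_right (by positivity) (inv_le_one_of_one_le₀ ?_)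
    linarith [Real.pi_gt_three]
  have h2 : ((scaleFactor j ^ d)⁻¹) ^ (p⁻¹).toReal ≤ (2 : ℝ) ^ ((j : ℝ) * (d * (p⁻¹).toReal)) := by
    rw [Real.rpow_mul zero_le_two, Real.rpow_mul (by positivity), Real.rpow_natCast, ← inv_pow]
    gcongr
  refine (ENNReal.ofReal_le_ofReal h2).trans (le_of_eq ?_)
  rw [← ENNReal.ofReal_rpow_of_pos two_pos]
  simp

/-- A reproducing formula: it exhibits each piece as a multiplier applied to its own `L^p`
representative, the form required by Bernstein's inequality and by the spectral lemma for products.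
-/
theorem wideCutoff_box (hψ : IsWindow ψ) (j : ℤ) (k : Fin d → ℤ) (f : 𝓢'(Eu d, ℂ)) :
    TemperedDistribution.fourierMultiplierCLM ℂ
      (symbol (wideCutoff d) (scaleFactor j) (latticePoint k)) (box ψ j k f) = box ψ j k f := by
  have ha := (scaleFactor_pos j).ne'
  rw [box_eq, TemperedDistribution.fourierMultiplierCLM_fourierMultiplierCLM_apply
    (hψ.isCutoff.hasTemperateGrowth_symbol ha _)
    ((isCutoff_wideCutoff d).hasTemperateGrowth_symbol ha _)]
  congr 2
  ext η
  simp only [Pi.mul_apply, symbol, ← Complex.ofReal_mul]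
  rw [mul_comm, hψ.wideCutoff_mul]

/-- The constituents of a distribution whose modulation norm is finite. -/
theorem IsWindow.exists_atoms (hψ : IsWindow ψ) (hp : p ≠ ∞) : ∃ B : ℝ≥0, ∀ (j : ℤ)
    (f : 𝓢'(Eu d, ℂ)), modNorm ψ p 1 j f ≠ ∞ →
    ∃ (g : (Fin d → ℤ) → Lp ℂ p (volume : Measure (Eu d))) (w : (Fin d → ℤ) → Eu d →ᵇ ℂ),
      (∀ k, w k = bcfMultiplier p (symbol (wideCutoff d) (scaleFactor j) (latticePoint k)) (g k)) ∧
      (∀ k, ofBCF (w k) = box ψ j k f) ∧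
      (∀ k, ‖w k‖ₑ ≤ B * 2 ^ ((j : ℝ) * (d * (p⁻¹).toReal)) * distLpNorm p (box ψ j k f)) ∧
      (Summable fun k => ‖w k‖) ∧ ofBCF (∑' k, w k) = f := by
  obtain ⟨B, hB⟩ := (isCutoff_wideCutoff d).exists_multiplier_bound hp
  refine ⟨B, fun j f hf => ?_⟩
  have hj := scaleFactor_pos j
  have htop : ∀ k, distLpNorm p (box ψ j k f) ≠ ∞ := by
    rw [modNorm_one] at hf
    exact ENNReal.ne_top_of_tsum_ne_top hf
  choose g hg hgn using fun k => exists_of_distLpNorm_ne_top (htop k)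
  set w : (Fin d → ℤ) → Eu d →ᵇ ℂ := fun k =>
    bcfMultiplier p (symbol (wideCutoff d) (scaleFactor j) (latticePoint k)) (g k) with hw
  have hwb : ∀ k, ‖w k‖ₑ ≤
      B * 2 ^ ((j : ℝ) * (d * (p⁻¹).toReal)) * distLpNorm p (box ψ j k f) := by
    intro k
    have h2 := ENNReal.ofReal_le_ofReal (hB _ hj (latticePoint k) (g k)).2
    rw [ENNReal.ofReal_mul (by positivity), ENNReal.ofReal_mul B.coe_nonneg, ofReal_norm, ofReal_norm,
      ENNReal.ofReal_coe_nnreal, hgn] at h2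
    refine h2.trans ?_
    gcongr
    exact scaleFactor_rpow_le p j
  have hws : Summable fun k => ‖w k‖ := by
    refine summable_norm_of_tsum_enorm_ne_top (ne_top_of_le_ne_top ?_ (ENNReal.tsum_le_tsum hwb))
    rw [ENNReal.tsum_mul_left, ← modNorm_one]
    finiteness
  have hwbox : ∀ k, ofBCF (w k) = box ψ j k f := by
    intro k
    rw [hw, (isCutoff_wideCutoff d).ofBCF_bcfMultiplier hp hj, hg, wideCutoff_box hψ]
  exact ⟨g, w, fun _ => rfl, hwbox, hwb, hws, hψ.ofBCF_eq_of_hasSum hwbox hws.of_norm.hasSum⟩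

theorem IsWindow.exists_embedding (hψ : IsWindow ψ) (hp : p ≠ ∞) : ∃ B : ℝ≥0, ∀ (j : ℤ)
    (f : 𝓢'(Eu d, ℂ)), modNorm ψ p 1 j f ≠ ∞ → ∃ u : Eu d →ᵇ ℂ, ofBCF u = f ∧
      ‖u‖ₑ ≤ B * 2 ^ ((j : ℝ) * (d * (p⁻¹).toReal)) * modNorm ψ p 1 j f := by
  obtain ⟨B, hB⟩ := hψ.exists_atoms (p := p) hp
  refine ⟨B, fun j f hf => ?_⟩
  obtain ⟨g, w, -, -, hwb, -, hwf⟩ := hB j f hf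
  refine ⟨_, hwf, (enorm_tsum_le w).trans ((ENNReal.tsum_le_tsum hwb).trans ?_)⟩
  rw [ENNReal.tsum_mul_left, ← modNorm_one]

/-- Both factors are expanded into pieces. Seen at scale `j`, the product of pieces `k` and `m` has
its spectrum near `k + 2^{l-j} m`, within a fixed radius since `l ≤ j`. The coarser factor is
measured in sup norm, so only its scale `l` enters the weight. -/
theorem IsWindow.exists_modNorm_mul_le (hψ : IsWindow ψ) (hp : p ≠ ∞) : ∃ C : ℝ≥0,
    ∀ (l j : ℤ) (u v : Eu d →ᵇ ℂ), l ≤ j → modNorm ψ p 1 j (ofBCF u) ≠ ∞ →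
      modNorm ψ p 1 l (ofBCF v) ≠ ∞ → modNorm ψ p 1 j (ofBCF (u * v)) ≤
        C * modNorm ψ p 1 j (ofBCF u) *
          (2 ^ ((l : ℝ) * (d * (p⁻¹).toReal)) * modNorm ψ p 1 l (ofBCF v)) := by
  obtain ⟨B, hB⟩ := hψ.exists_atoms (p := p) hp
  obtain ⟨A, hA⟩ := hψ.isCutoff.exists_distLpNorm_box_le (p := p) hp
  set R := windowRadius d + 2 with hR
  obtain ⟨N, hN⟩ := exists_finset_lattice d (3 * R)
  -- `N` counts the boxes meeting the spectrum of one product, `A` bounds a box on `L^p`, and `B` is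
  -- the Bernstein constant.
  refine ⟨N * A * B, fun l j u v hlj hu hv => ?_⟩
  obtain ⟨g, w, hwg, hwbox, -, hws, hwu⟩ := hB j _ hu
  obtain ⟨g', z, hzg, -, hzb, hzs, hzv⟩ := hB l _ hv
  have hu' := ofBCF_injective hwu
  have hv' := ofBCF_injective hzv
  have hsum : HasSum (fun x : (Fin d → ℤ) × (Fin d → ℤ) => w x.1 * z x.2) (u * v) := by
    rw [← hu', ← hv', tsum_mul_tsum_of_summable_norm hws hzs]
    exact (summable_mul_of_summable_norm hws hzs).hasSum
  have hatom : ∀ k m, modNorm ψ p 1 j (ofBCF (w k * z m)) ≤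
      N * (A * (distLpNorm p (box ψ j k (ofBCF u)) * ‖z m‖ₑ)) := by
    intro k m
    obtain ⟨S, hSN, hS⟩ := hN (latticePoint k +
      (scaleFactor j / scaleFactor l) • latticePoint m)
    have hzero : ∀ k' ∉ S, distLpNorm p (box ψ j k' (ofBCF (w k * z m))) = 0 := by
      intro k' hk'
      have hfar : 3 * R < ‖latticePoint k' - (latticePoint k +
          (scaleFactor j / scaleFactor l) • latticePoint m)‖ := by
        by_contra hle
        exact hk' (hS k' (not_lt.1 hle))
      rw [box_eq, hwg, hzg, fourierMultiplierCLM_mul_eq_zero hp (isCutoff_wideCutoff d)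
        hψ.isCutoff (fun ξ hξ => norm_le_of_wideCutoff_ne_zero hξ)
        (fun ξ hξ => (hψ.norm_le hξ).trans (by linarith)) (scaleFactor_pos j) (scaleFactor_le hlj)
        hfar, distLpNorm_zero]
    rw [modNorm_one, tsum_eq_sum hzero]
    calc ∑ k' ∈ S, distLpNorm p (box ψ j k' (ofBCF (w k * z m)))
        ≤ ∑ _k' ∈ S, A * (distLpNorm p (box ψ j k (ofBCF u)) * ‖z m‖ₑ) := by
          refine Finset.sum_le_sum fun k' _ => (hA j k' _).trans ?_
          gcongr
          rw [← hwbox]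
          exact distLpNorm_ofBCF_mul_le _ _
      _ ≤ _ := by
          rw [Finset.sum_const, nsmul_eq_mul]
          gcongr
  have hsum' := hsum.map ofBCF ofBCF.continuous
  calc modNorm ψ p 1 j (ofBCF (u * v))
      ≤ ∑' x : (Fin d → ℤ) × (Fin d → ℤ), modNorm ψ p 1 j (ofBCF (w x.1 * z x.2)) :=
        modNorm_le_tsum hsum' j
    _ ≤ ∑' x : (Fin d → ℤ) × (Fin d → ℤ), N * A * B * (distLpNorm p (box ψ j x.1 (ofBCF u)) *
          (2 ^ ((l : ℝ) * (d * (p⁻¹).toReal)) * distLpNorm p (box ψ l x.2 (ofBCF v)))) := by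
        refine ENNReal.tsum_le_tsum fun x => (hatom x.1 x.2).trans ?_
        calc (N : ℝ≥0∞) * (A * (distLpNorm p (box ψ j x.1 (ofBCF u)) * ‖z x.2‖ₑ))
            ≤ N * (A * (distLpNorm p (box ψ j x.1 (ofBCF u)) *
              (B * 2 ^ ((l : ℝ) * (d * (p⁻¹).toReal)) * distLpNorm p (box ψ l x.2 (ofBCF v))))) := by
              gcongr
              exact hzb x.2
          _ = _ := by ring
    _ = _ := by
        rw [ENNReal.tsum_mul_left, ENNReal.tsum_prod (f := fun k m => distLpNorm p
          (box ψ j k (ofBCF u)) * (2 ^ ((l : ℝ) * (d * (p⁻¹).toReal)) *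
            distLpNorm p (box ψ l m (ofBCF v))))]
        simp only [ENNReal.tsum_mul_left, ENNReal.tsum_mul_right, ← modNorm_one]
        push_cast
        ring

end ModulationNorm

section ScalingNorm

/-! ### Sequence norms -/

section EllNorm

variable {ι κ : Type*} {r : ℝ}

theorem ellNorm_rpow (hr : 1 ≤ r) (a : ι → ℝ≥0∞) : ellNorm r a ^ r = ∑' i, a i ^ r := by
  rw [ellNorm, ← ENNReal.rpow_mul, one_div_mul_cancel (by linarith), ENNReal.rpow_one]

theorem ellNorm_mono (hr : 1 ≤ r) {a b : ι → ℝ≥0∞} (h : ∀ i, a i ≤ b i) :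
    ellNorm r a ≤ ellNorm r b :=
  ENNReal.rpow_le_rpow (ENNReal.tsum_le_tsum fun i => ENNReal.rpow_le_rpow (h i) (by linarith))
    (by positivity)

theorem ellNorm_le_of_forall_finset (hr : 1 ≤ r) {a : ι → ℝ≥0∞} {B : ℝ≥0∞}
    (h : ∀ s : Finset ι, (∑ i ∈ s, a i ^ r) ^ (1 / r) ≤ B) : ellNorm r a ≤ B := by
  have hr0 : 0 < r := by linarith
  rw [← ENNReal.rpow_le_rpow_iff hr0, ellNorm_rpow hr, ENNReal.tsum_eq_iSup_sum]
  refine iSup_le fun s => ?_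
  have := ENNReal.rpow_le_rpow (h s) hr0.le
  rwa [← ENNReal.rpow_mul, one_div_mul_cancel hr0.ne', ENNReal.rpow_one] at this

theorem finset_le_ellNorm (hr : 1 ≤ r) (a : ι → ℝ≥0∞) (s : Finset ι) :
    (∑ i ∈ s, a i ^ r) ^ (1 / r) ≤ ellNorm r a :=
  ENNReal.rpow_le_rpow (ENNReal.sum_le_tsum s) (by positivity)

theorem le_ellNorm (hr : 1 ≤ r) (a : ι → ℝ≥0∞) (i : ι) : a i ≤ ellNorm r a := by
  have := finset_le_ellNorm hr a {i}
  rwa [Finset.sum_singleton, ← ENNReal.rpow_mul, mul_one_div_cancel (by linarith),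
    ENNReal.rpow_one] at this

theorem ellNorm_mul_left (hr : 1 ≤ r) (c : ℝ≥0∞) (a : ι → ℝ≥0∞) :
    ellNorm r (fun i => c * a i) = c * ellNorm r a := by
  have hr0 : 0 ≤ r := by linarith
  simp only [ellNorm, ENNReal.mul_rpow_of_nonneg _ _ hr0]
  rw [ENNReal.tsum_mul_left, ENNReal.mul_rpow_of_nonneg _ _ (by positivity), ← ENNReal.rpow_mul,
    mul_one_div_cancel (by linarith), ENNReal.rpow_one]

theorem ellNorm_add_le (hr : 1 ≤ r) (a b : ι → ℝ≥0∞) :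
    ellNorm r (fun i => a i + b i) ≤ ellNorm r a + ellNorm r b :=
  ellNorm_le_of_forall_finset hr fun s => (ENNReal.Lp_add_le s a b hr).trans
    (add_le_add (finset_le_ellNorm hr a s) (finset_le_ellNorm hr b s))

theorem ellNorm_zero (hr : 1 ≤ r) : ellNorm r (fun _ : ι => 0) = 0 := by
  have h1 : 0 < r := by linarith
  simp [ellNorm, h1]

theorem ellNorm_sum_le (hr : 1 ≤ r) (a : κ → ι → ℝ≥0∞) (t : Finset κ) :
    ellNorm r (fun i => ∑ n ∈ t, a n i) ≤ ∑ n ∈ t, ellNorm r (a n) := by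
  classical
  induction t using Finset.induction_on with
  | empty => simp [ellNorm_zero hr]
  | insert n t hn ih =>
    simp only [Finset.sum_insert hn]
    exact (ellNorm_add_le hr _ _).trans (add_le_add le_rfl ih)

theorem ellNorm_tsum_le (hr : 1 ≤ r) (a : κ → ι → ℝ≥0∞) :
    ellNorm r (fun i => ∑' n, a n i) ≤ ∑' n, ellNorm r (a n) := by
  refine ellNorm_le_of_forall_finset hr fun s => ?_
  have h1 : Tendsto (fun t : Finset κ => (∑ i ∈ s, (∑ n ∈ t, a n i) ^ r) ^ (1 / r)) atTop
      (𝓝 ((∑ i ∈ s, (∑' n, a n i) ^ r) ^ (1 / r))) := by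
    refine (ENNReal.continuous_rpow_const.tendsto _).comp (tendsto_finsetSum _ fun i _ => ?_)
    exact (ENNReal.continuous_rpow_const.tendsto _).comp ENNReal.summable.hasSum
  refine le_of_tendsto' h1 fun t => (finset_le_ellNorm hr _ s).trans ?_
  exact (ellNorm_sum_le hr a t).trans (ENNReal.sum_le_tsum t)

theorem tsum_mul_le_ellNorm {q : ℝ} (hrq : r.HolderConjugate q) (a b : ι → ℝ≥0∞) :
    ∑' i, a i * b i ≤ ellNorm r a * ellNorm q b := by
  rw [ENNReal.tsum_eq_iSup_sum]
  exact iSup_le fun s => (ENNReal.inner_le_Lp_mul_Lq s a b hrq).trans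
    (mul_le_mul' (finset_le_ellNorm hrq.lt.le a s) (finset_le_ellNorm hrq.symm.lt.le b s))

/-- Serves to pass from near-optimal decompositions to the infimum. The claim fails for `c = ∞`, `y
= 0`, and for `y = ∞` the assumption is vacuous. -/
theorem le_mul_of_forall_gt {X c y : ℝ≥0∞} (hc : c ≠ ∞) (hy : y ≠ ∞)
    (h : ∀ y', y < y' → X ≤ c * y') : X ≤ c * y := by
  rw [mul_comm, ← ENNReal.div_le_iff_le_mul (.inr hy) (.inl hc)]
  refine le_of_forall_gt_imp_ge_of_dense fun y' hy' => ?_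
  exact ENNReal.div_le_of_le_mul ((h y' hy').trans (mul_comm _ _).le)

end EllNorm

/-- The scales in `J` with the weight `2^{jμ}` in `ℓ^r` control the weight `2^{js}` in `ℓ^1`. -/
def WeightControl (J : Set ℤ) (r μ s : ℝ) : Prop :=
  ∃ C : ℝ≥0∞, C ≠ ∞ ∧ ∀ a : J → ℝ≥0∞, ∑' j : J, (2 : ℝ≥0∞) ^ (((j : ℤ) : ℝ) * s) * a j ≤
    C * ellNorm r fun j : J => (2 : ℝ≥0∞) ^ (((j : ℤ) : ℝ) * μ) * a j

theorem weightControl_self (J : Set ℤ) (s : ℝ) : WeightControl J 1 s s :=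
  ⟨1, ENNReal.one_ne_top, fun a => by rw [ellNorm_one, one_mul]⟩

theorem weightControl_one {s μ : ℝ} (h : s ≤ μ) : WeightControl (Ici 0) 1 μ s := by
  refine ⟨1, ENNReal.one_ne_top, fun a => ?_⟩
  rw [ellNorm_one, one_mul]
  refine ENNReal.tsum_le_tsum fun j => ?_
  have hj : (0 : ℝ) ≤ ((j : ℤ) : ℝ) := by exact_mod_cast j.2
  gcongr
  exact one_le_two

/-- Hölder applied to `2^{js} = 2^{j(s-μ)} 2^{jμ}`; the first factor is geometric over `j ≥ 0` and
so lies in `ℓ^q` for the conjugate exponent `q`. -/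
theorem weightControl_of_lt {r s μ : ℝ} (hr : 1 < r) (h : s < μ) :
    WeightControl (Ici 0) r μ s := by
  have hrq := Real.HolderConjugate.conjExponent hr
  set q := r.conjExponent
  have hq : 1 < q := hrq.symm.lt
  refine ⟨ellNorm q fun j : Ici (0 : ℤ) => (2 : ℝ≥0∞) ^ (((j : ℤ) : ℝ) * (s - μ)), ?_, fun a => ?_⟩
  · refine ENNReal.rpow_ne_top_of_nonneg (by positivity) ?_
    set x : ℝ≥0∞ := (2 : ℝ≥0∞) ^ ((s - μ) * q)
    have hx : x < 1 := ENNReal.rpow_lt_one_of_one_lt_of_neg (by norm_num) (by nlinarith)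
    have e : ∀ j : Ici (0 : ℤ), ((2 : ℝ≥0∞) ^ (((j : ℤ) : ℝ) * (s - μ))) ^ q =
        x ^ (j : ℤ).toNat := by
      intro j
      have hj : (((j : ℤ).toNat : ℕ) : ℝ) = ((j : ℤ) : ℝ) := by
        exact_mod_cast Int.toNat_of_nonneg j.2
      rw [← ENNReal.rpow_natCast, hj, ← ENNReal.rpow_mul, ← ENNReal.rpow_mul]
      congr 1
      ring
    simp only [e]
    have hinj : Function.Injective fun j : Ici (0 : ℤ) => (j : ℤ).toNat := by
      intro i j hij
      have hi : (0 : ℤ) ≤ i := i.2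
      have hj : (0 : ℤ) ≤ j := j.2
      have : (i : ℤ).toNat = (j : ℤ).toNat := hij
      exact Subtype.ext (by omega)
    refine ne_top_of_le_ne_top ?_ (ENNReal.tsum_comp_le_tsum_of_injective hinj fun n => x ^ n)
    rw [ENNReal.tsum_geometric]
    exact ENNReal.inv_ne_top.2 (tsub_pos_of_lt hx).ne'
  · refine le_trans (le_of_eq ?_) (tsum_mul_le_ellNorm hrq.symm _ _)
    refine tsum_congr fun j => ?_
    rw [← mul_assoc, ← ENNReal.rpow_add _ _ two_ne_zero ENNReal.ofNat_ne_top]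
    congr 2
    ring

variable {d : ℕ} {p : ℝ≥0∞} [Fact (1 ≤ p)] {ψ : Eu d → ℝ} {J : Set ℤ} {r μ : ℝ}

/-! ### The scaling limit spaces -/

/-- The weighted sequence norm of a decomposition. -/
def decompNorm (ψ : Eu d → ℝ) (p : ℝ≥0∞) [Fact (1 ≤ p)] (r μ : ℝ) (F : J → 𝓢'(Eu d, ℂ)) : ℝ≥0∞ :=
  ellNorm r fun j : J => (2 : ℝ≥0∞) ^ (((j : ℤ) : ℝ) * μ) * modNorm ψ p 1 (j : ℤ) (F j)

theorem scalingNorm_le {F : J → 𝓢'(Eu d, ℂ)} {f : 𝓢'(Eu d, ℂ)} (h : HasSum F f) :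
    scalingNorm ψ J p 1 r μ f ≤ decompNorm ψ p r μ F :=
  iInf₂_le (f := fun (F : J → 𝓢'(Eu d, ℂ)) (_ : HasSum F f) => decompNorm ψ p r μ F) F h

theorem exists_decomp {f : 𝓢'(Eu d, ℂ)} {c : ℝ≥0∞} (h : scalingNorm ψ J p 1 r μ f < c) :
    ∃ F : J → 𝓢'(Eu d, ℂ), HasSum F f ∧ decompNorm ψ p r μ F < c := by
  obtain ⟨F, hF⟩ := iInf_lt_iff.1 h
  obtain ⟨h1, h2⟩ := iInf_lt_iff.1 hF
  exact ⟨F, h1, h2⟩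

theorem modNorm_ne_top_of_decompNorm (hr : 1 ≤ r) {F : J → 𝓢'(Eu d, ℂ)}
    (h : decompNorm ψ p r μ F ≠ ∞) (j : J) : modNorm ψ p 1 (j : ℤ) (F j) ≠ ∞ := by
  intro h1
  have h2 := le_ellNorm hr (fun j : J =>
    (2 : ℝ≥0∞) ^ (((j : ℤ) : ℝ) * μ) * modNorm ψ p 1 (j : ℤ) (F j)) j
  simp only [h1] at h2
  rw [ENNReal.mul_top (by simp)] at h2
  exact h (top_le_iff.1 h2)

/-- The embedding at scale `j` costs `2^{jd/p}`, exactly the weight whose `ℓ^1` sum `WeightControl`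
bounds. Decompositions of finite norm thus converge absolutely and uniformly. -/
theorem IsWindow.exists_decomp_bcf (hψ : IsWindow ψ) (hp : p ≠ ∞) (hr : 1 ≤ r)
    (hw : WeightControl J r μ (d * (p⁻¹).toReal)) : ∃ C : ℝ≥0∞, C ≠ ∞ ∧
    ∀ F : J → 𝓢'(Eu d, ℂ), decompNorm ψ p r μ F ≠ ∞ → ∃ u : J → Eu d →ᵇ ℂ,
      (∀ j, ofBCF (u j) = F j) ∧ ∑' j, ‖u j‖ₑ ≤ C * decompNorm ψ p r μ F := by
  obtain ⟨B, hB⟩ := hψ.exists_embedding (p := p) hp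
  obtain ⟨C, hC, hw⟩ := hw
  refine ⟨B * C, by finiteness, fun F hF => ?_⟩
  choose u hu hub using fun j : J => hB j (F j) (modNorm_ne_top_of_decompNorm hr hF j)
  refine ⟨u, hu, (ENNReal.tsum_le_tsum hub).trans ?_⟩
  simp only [mul_assoc]
  rw [ENNReal.tsum_mul_left]
  gcongr
  exact hw _

theorem hasSum_ofBCF {ι : Type*} {u : ι → Eu d →ᵇ ℂ} (h : ∑' i, ‖u i‖ₑ ≠ ∞) :
    HasSum (fun i => ofBCF (u i)) (ofBCF (∑' i, u i)) :=
  (summable_norm_of_tsum_enorm_ne_top h).of_norm.hasSum.map ofBCF ofBCF.continuous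

theorem IsWindow.exists_bcf (hψ : IsWindow ψ) (hp : p ≠ ∞) (hr : 1 ≤ r)
    (hw : WeightControl J r μ (d * (p⁻¹).toReal)) : ∃ C : ℝ≥0∞, C ≠ ∞ ∧
    ∀ f : 𝓢'(Eu d, ℂ), scalingNorm ψ J p 1 r μ f ≠ ∞ → ∃ u : Eu d →ᵇ ℂ, ofBCF u = f ∧
      ‖u‖ₑ ≤ C * scalingNorm ψ J p 1 r μ f := by
  obtain ⟨C, hC, h⟩ := hψ.exists_decomp_bcf hp hr hw
  have key : ∀ f : 𝓢'(Eu d, ℂ), ∀ c, scalingNorm ψ J p 1 r μ f < c → ∃ u : Eu d →ᵇ ℂ,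
      ofBCF u = f ∧ ‖u‖ₑ ≤ C * c := by
    intro f c hc
    obtain ⟨F, hF, hFc⟩ := exists_decomp hc
    obtain ⟨u, hu, hub⟩ := h F hFc.ne_top
    have hfin : ∑' j, ‖u j‖ₑ ≠ ∞ := ne_top_of_le_ne_top (ENNReal.mul_ne_top hC hFc.ne_top) hub
    have h1 := hasSum_ofBCF hfin
    simp only [hu] at h1
    refine ⟨_, h1.unique hF, (enorm_tsum_le u).trans (hub.trans ?_)⟩
    gcongr
  refine ⟨C, hC, fun f hf => ?_⟩
  -- The function is fixed before the bound is optimised; each `c` yields its own representative,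
  -- and injectivity of `ofBCF` identifies it with `u`.
  obtain ⟨u, hu, -⟩ := key f ∞ hf.lt_top
  refine ⟨u, hu, le_mul_of_forall_gt hC hf fun c hc => ?_⟩
  obtain ⟨v, hv, hvb⟩ := key f c hc
  rwa [ofBCF_injective (hu.trans hv.symm)]

/-- The double family over `ι × J` is absolutely summable in the sup norm, so it can be regrouped by
scale. Its `j`-th component `∑ n, F n j` gives a decomposition of the total, estimated by
Minkowski's inequality in `ℓ^r`. -/
theorem IsWindow.exists_hasSum_scalingNorm_le_decompNorm (hψ : IsWindow ψ) (hp : p ≠ ∞) (hr : 1 ≤ r)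
    (hw : WeightControl J r μ (d * (p⁻¹).toReal)) {ι : Type*} {G : ι → 𝓢'(Eu d, ℂ)}
    {F : ι → J → 𝓢'(Eu d, ℂ)} (hF : ∀ n, HasSum (F n) (G n))
    (hfin : ∑' n, decompNorm ψ p r μ (F n) ≠ ∞) :
    ∃ f, HasSum G f ∧ scalingNorm ψ J p 1 r μ f ≤ ∑' n, decompNorm ψ p r μ (F n) := by
  obtain ⟨C, hC, h⟩ := hψ.exists_decomp_bcf hp hr hw
  choose u hu hub using fun n => h (F n) (ENNReal.ne_top_of_tsum_ne_top hfin n)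
  have h1 : ∑' x : ι × J, ‖u x.1 x.2‖ₑ ≠ ∞ := by
    rw [ENNReal.tsum_prod (f := fun n j => ‖u n j‖ₑ)]
    refine ne_top_of_le_ne_top ?_ (ENNReal.tsum_le_tsum hub)
    rw [ENNReal.tsum_mul_left]
    exact ENNReal.mul_ne_top hC hfin
  have hs : Summable fun x : ι × J => u x.1 x.2 := (summable_norm_of_tsum_enorm_ne_top h1).of_norm
  have hn : ∀ n, HasSum (fun j => ofBCF (u n j)) (ofBCF (∑' j, u n j)) := fun n =>
    (hs.prod_factor n).hasSum.map ofBCF ofBCF.continuous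
  have hj : ∀ j, HasSum (fun n => ofBCF (u n j)) (ofBCF (∑' n, u n j)) := fun j =>
    (hs.prod_symm.prod_factor j).hasSum.map ofBCF ofBCF.continuous
  have hG : G = fun n => ofBCF (∑' j, u n j) := by
    funext n
    refine (hF n).unique ?_
    simpa only [hu] using hn n
  refine ⟨ofBCF (∑' x : ι × J, u x.1 x.2), ?_, ?_⟩
  · rw [hG]
    exact (hs.hasSum.prod_fiberwise fun n => (hs.prod_factor n).hasSum).map ofBCF ofBCF.continuous
  · have hsum : HasSum (fun j => ofBCF (∑' n, u n j)) (ofBCF (∑' x : ι × J, u x.1 x.2)) := by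
      have h2 : HasSum (fun x : J × ι => u x.2 x.1) (∑' x : ι × J, u x.1 x.2) :=
        (Equiv.prodComm J ι).hasSum_iff.2 hs.hasSum
      exact (h2.prod_fiberwise fun j => (hs.prod_symm.prod_factor j).hasSum).map ofBCF
        ofBCF.continuous
    refine (scalingNorm_le hsum).trans ?_
    refine le_trans (ellNorm_mono hr fun j => ?_) (ellNorm_tsum_le hr _)
    rw [ENNReal.tsum_mul_left]
    gcongr
    refine (modNorm_le_tsum (hj j) j).trans (le_of_eq ?_)
    simp only [hu]

/-- Near-optimal decompositions are chosen with positive slacks of total less than `ε`; countability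
of `ι` makes this possible. The triangle inequality (two terms) and completeness (absolutely
convergent series) both follow from it. -/
theorem IsWindow.exists_hasSum_scalingNorm_le (hψ : IsWindow ψ) (hp : p ≠ ∞) (hr : 1 ≤ r)
    (hw : WeightControl J r μ (d * (p⁻¹).toReal)) {ι : Type*} [Countable ι]
    {G : ι → 𝓢'(Eu d, ℂ)} (hfin : ∑' n, scalingNorm ψ J p 1 r μ (G n) ≠ ∞) :
    ∃ f, HasSum G f ∧ scalingNorm ψ J p 1 r μ f ≤ ∑' n, scalingNorm ψ J p 1 r μ (G n) := by
  have key : ∀ ε : ℝ≥0, 0 < ε → ∃ f, HasSum G f ∧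
      scalingNorm ψ J p 1 r μ f ≤ ∑' n, scalingNorm ψ J p 1 r μ (G n) + ε := by
    intro ε hε
    obtain ⟨δ, hδ, hδε⟩ := ENNReal.exists_pos_sum_of_countable'
      (ε := (ε : ℝ≥0∞)) (by exact_mod_cast hε.ne') ι
    choose F hF hFb using fun n => exists_decomp
      (ENNReal.lt_add_right (ENNReal.ne_top_of_tsum_ne_top hfin n) (hδ n).ne')
    have hle : ∑' n, decompNorm ψ p r μ (F n) ≤ ∑' n, scalingNorm ψ J p 1 r μ (G n) + ε := by
      refine (ENNReal.tsum_le_tsum fun n => (hFb n).le).trans ?_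
      rw [ENNReal.tsum_add]
      gcongr
    obtain ⟨f, hf, hfb⟩ := hψ.exists_hasSum_scalingNorm_le_decompNorm hp hr hw hF
      (ne_top_of_le_ne_top (by finiteness) hle)
    exact ⟨f, hf, hfb.trans hle⟩
  obtain ⟨f, hf, -⟩ := key 1 one_pos
  refine ⟨f, hf, ENNReal.le_of_forall_pos_le_add fun ε hε _ => ?_⟩
  obtain ⟨f', hf', hb⟩ := key ε hε
  rwa [hf.unique hf']

end ScalingNorm

/-! ### Norm axioms, completeness and the product estimate -/

section Algebra

variable {d : ℕ} {p : ℝ≥0∞} [Fact (1 ≤ p)] {ψ : Eu d → ℝ} {J : Set ℤ} {r μ : ℝ}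

theorem scalingNorm_zero (hr : 1 ≤ r) : scalingNorm ψ J p 1 r μ (0 : 𝓢'(Eu d, ℂ)) = 0 := by
  refine le_antisymm ((scalingNorm_le (F := fun _ => 0) hasSum_zero).trans (le_of_eq ?_)) zero_le
  simp only [decompNorm, modNorm_zero, mul_zero]
  exact ellNorm_zero hr

theorem scalingNorm_smul_le (hr : 1 ≤ r) {c : ℂ} (hc : c ≠ 0) (f : 𝓢'(Eu d, ℂ)) :
    scalingNorm ψ J p 1 r μ (c • f) ≤ ‖c‖ₑ * scalingNorm ψ J p 1 r μ f := by
  by_cases htop : scalingNorm ψ J p 1 r μ f = ∞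
  · rw [htop, ENNReal.mul_top (by simpa using hc)]; exact le_top
  refine le_mul_of_forall_gt enorm_ne_top htop fun y hy => ?_
  obtain ⟨F, hF, hFy⟩ := exists_decomp hy
  have h1 : HasSum (fun j => c • F j) (c • f) := hF.const_smul c
  refine (scalingNorm_le h1).trans (le_trans ?_ (mul_le_mul_right hFy.le _))
  rw [decompNorm, decompNorm, ← ellNorm_mul_left hr]
  refine ellNorm_mono hr fun j => ?_
  rw [mul_left_comm]
  gcongr
  exact modNorm_smul_le c j (F j)

theorem scalingNorm_smul (hr : 1 ≤ r) (c : ℂ) (f : 𝓢'(Eu d, ℂ)) :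
    scalingNorm ψ J p 1 r μ (c • f) = ‖c‖ₑ * scalingNorm ψ J p 1 r μ f := by
  by_cases hc : c = 0
  · rw [hc, show (0 : ℂ) • f = 0 from zero_smul ℂ f, scalingNorm_zero hr]
    simp
  refine le_antisymm (scalingNorm_smul_le hr hc f) ?_
  have h1 := scalingNorm_smul_le (ψ := ψ) (p := p) (J := J) (μ := μ) hr (inv_ne_zero hc) (c • f)
  rw [show c⁻¹ • c • f = f from inv_smul_smul₀ hc f] at h1
  calc ‖c‖ₑ * scalingNorm ψ J p 1 r μ f
      ≤ ‖c‖ₑ * (‖c⁻¹‖ₑ * scalingNorm ψ J p 1 r μ (c • f)) := by gcongr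
    _ = scalingNorm ψ J p 1 r μ (c • f) := by
      rw [← mul_assoc, ← enorm_mul, mul_inv_cancel₀ hc, enorm_one, one_mul]

theorem IsWindow.scalingNorm_add_le (hψ : IsWindow ψ) (hp : p ≠ ∞) (hr : 1 ≤ r)
    (hw : WeightControl J r μ (d * (p⁻¹).toReal)) (f g : 𝓢'(Eu d, ℂ)) :
    scalingNorm ψ J p 1 r μ (f + g) ≤ scalingNorm ψ J p 1 r μ f + scalingNorm ψ J p 1 r μ g := by
  by_cases htop : scalingNorm ψ J p 1 r μ f + scalingNorm ψ J p 1 r μ g = ∞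
  · rw [htop]; exact le_top
  have e : ∑' n, scalingNorm ψ J p 1 r μ (![f, g] n) =
      scalingNorm ψ J p 1 r μ f + scalingNorm ψ J p 1 r μ g := by
    rw [tsum_fintype, Fin.sum_univ_two]
    rfl
  obtain ⟨h, hh, hb⟩ := hψ.exists_hasSum_scalingNorm_le (J := J) (μ := μ) hp hr hw (G := ![f, g])
    (by rwa [e])
  have h2 : HasSum ![f, g] (f + g) := by
    have := hasSum_fintype ![f, g]
    rw [Fin.sum_univ_two] at this
    exact this
  rw [e] at hb
  rwa [h2.unique hh]

theorem IsWindow.scalingNorm_complete (hψ : IsWindow ψ) (hp : p ≠ ∞) (hr : 1 ≤ r)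
    (hw : WeightControl J r μ (d * (p⁻¹).toReal)) (F : ℕ → 𝓢'(Eu d, ℂ))
    (hF : ∀ n, scalingNorm ψ J p 1 r μ (F n) < ∞)
    (hc : ∀ ε : ℝ≥0∞, 0 < ε → ∃ n₀, ∀ m ≥ n₀, ∀ n ≥ n₀,
      scalingNorm ψ J p 1 r μ (F m - F n) < ε) :
    ∃ f, scalingNorm ψ J p 1 r μ f < ∞ ∧
      Tendsto (fun n => scalingNorm ψ J p 1 r μ (F n - f)) atTop (𝓝 0) := by
  set N := scalingNorm ψ J p 1 r μ with hN
  have hδ : ∀ i : ℕ, (0 : ℝ≥0∞) < 2⁻¹ ^ i := fun i => ENNReal.pow_pos (by simp) i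
  choose n₀ hn₀ using fun i => hc (2⁻¹ ^ i) (hδ i)
  -- Partial sums make the chosen indices monotone while keeping `n₀ i ≤ n i`.
  let n : ℕ → ℕ := fun i => ∑ m ∈ Finset.range (i + 1), n₀ m
  have hnn : ∀ i, n₀ i ≤ n i := fun i =>
    Finset.single_le_sum (f := n₀) (fun _ _ => Nat.zero_le _) (Finset.mem_range.2 (Nat.lt_succ_self i))
  have hmono : ∀ i, n i ≤ n (i + 1) := fun i => by
    simp only [n]
    rw [Finset.sum_range_succ _ (i + 1)]
    exact Nat.le_add_right _ _
  have hstep : ∀ i, N (F (n (i + 1)) - F (n i)) < 2⁻¹ ^ i := fun i =>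
    hn₀ i _ ((hnn i).trans (hmono i)) _ (hnn i)
  have hgeom : ∀ i : ℕ, ∑' m : ℕ, (2⁻¹ : ℝ≥0∞) ^ (m + i) = 2 * 2⁻¹ ^ i := by
    intro i
    simp only [pow_add]
    rw [ENNReal.tsum_mul_right, ENNReal.tsum_geometric, ENNReal.one_sub_inv_two, inv_inv]
  have htail : ∀ i, ∃ f, HasSum (fun m => F (n (m + i + 1)) - F (n (m + i))) f ∧
      N f ≤ 2 * 2⁻¹ ^ i := by
    intro i
    have h1 : ∑' m, N (F (n (m + i + 1)) - F (n (m + i))) ≤ 2 * 2⁻¹ ^ i := by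
      rw [← hgeom]
      exact ENNReal.tsum_le_tsum fun m => (hstep (m + i)).le
    obtain ⟨f, hf, hb⟩ := hψ.exists_hasSum_scalingNorm_le (J := J) (μ := μ) hp hr hw
      (G := fun m => F (n (m + i + 1)) - F (n (m + i)))
      (ne_top_of_le_ne_top (by finiteness) h1)
    exact ⟨f, hf, hb.trans h1⟩
  choose T hT hTb using htail
  have hlim : ∀ i, Tendsto (fun m => F (n (m + i))) atTop (𝓝 (F (n i) + T i)) := by
    intro i
    have h1 := (hT i).tendsto_sum_nat
    have h2 : ∀ M, ∑ m ∈ Finset.range M, (F (n (m + i + 1)) - F (n (m + i))) =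
        F (n (M + i)) - F (n i) := by
      intro M
      have := Finset.sum_range_sub (fun m => F (n (m + i))) M
      simp only [zero_add] at this
      rw [← this]
      exact Finset.sum_congr rfl fun m _ => by rw [add_right_comm]
    simp only [h2] at h1
    have h3 := h1.const_add (F (n i))
    simpa only [add_sub_cancel] using h3
  -- All tails describe one distributional limit, so `F (n i)` differs from it by `-T i`, of norm at
  -- most `2 * 2⁻¹ ^ i`.
  have hsame : ∀ i, F (n i) + T i = F (n 0) + T 0 := by
    intro i
    refine tendsto_nhds_unique (hlim i) ?_
    exact (hlim 0).comp (tendsto_add_atTop_nat i)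
  refine ⟨F (n 0) + T 0, ?_, ?_⟩
  · refine (hψ.scalingNorm_add_le hp hr hw _ _).trans_lt (ENNReal.add_lt_top.2 ⟨hF _, ?_⟩)
    exact (hTb 0).trans_lt (by finiteness)
  · have hneg : ∀ i, N (-T i) ≤ 2 * 2⁻¹ ^ i := by
      intro i
      rw [show -T i = (-1 : ℂ) • T i from (neg_one_smul ℂ (T i)).symm, hN, scalingNorm_smul hr]
      simpa using hTb i
    have hbound : ∀ i, ∀ m ≥ n i, N (F m - (F (n 0) + T 0)) ≤ 3 * 2⁻¹ ^ i := by
      intro i m hm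
      have e : F m - (F (n 0) + T 0) = (F m - F (n i)) + -T i := by
        rw [← hsame i]; abel
      rw [e]
      refine (hψ.scalingNorm_add_le hp hr hw _ _).trans
        ((add_le_add (hn₀ i m ((hnn i).trans hm) (n i) (hnn i)).le (hneg i)).trans (le_of_eq ?_))
      ring
    rw [ENNReal.tendsto_atTop_zero]
    intro ε hε
    have h3 : Tendsto (fun i : ℕ => 3 * (2⁻¹ : ℝ≥0∞) ^ i) atTop (𝓝 (3 * 0)) :=
      ENNReal.Tendsto.const_mul (ENNReal.tendsto_pow_atTop_nhds_zero_of_lt_one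
        (by simp)) (.inr (by simp))
    rw [mul_zero] at h3
    obtain ⟨i, hi⟩ := (h3.eventually (ge_mem_nhds hε)).exists
    exact ⟨n i, fun m hm => (hbound i m hm).trans hi⟩

theorem modNorm_add_le (j : ℤ) (f g : 𝓢'(Eu d, ℂ)) :
    modNorm ψ p 1 j (f + g) ≤ modNorm ψ p 1 j f + modNorm ψ p 1 j g := by
  have h1 : HasSum ![f, g] (f + g) := by
    have := hasSum_fintype ![f, g]
    rw [Fin.sum_univ_two] at this
    exact this
  have h2 := modNorm_le_tsum (ψ := ψ) (p := p) h1 j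
  rw [tsum_fintype, Fin.sum_univ_two] at h2
  exact h2

/-- A sum of products with factors of a lower scale. -/
theorem modNorm_tsum_ite_mul_le {C : ℝ≥0} {j : J} {q : J → Prop} [DecidablePred q]
    {u : Eu d →ᵇ ℂ} {v : J → Eu d →ᵇ ℂ} {s : ℝ}
    (hmul : ∀ l, q l → modNorm ψ p 1 (j : ℤ) (ofBCF (u * v l)) ≤
      C * modNorm ψ p 1 (j : ℤ) (ofBCF u) *
        (2 ^ (((l : ℤ) : ℝ) * s) * modNorm ψ p 1 (l : ℤ) (ofBCF (v l))))
    (hs : Summable fun l => if q l then u * v l else 0) :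
    modNorm ψ p 1 (j : ℤ) (ofBCF (∑' l, if q l then u * v l else 0)) ≤
      C * modNorm ψ p 1 (j : ℤ) (ofBCF u) *
        ∑' l : J, 2 ^ (((l : ℤ) : ℝ) * s) * modNorm ψ p 1 (l : ℤ) (ofBCF (v l)) := by
  refine (modNorm_le_tsum (hs.hasSum.map ofBCF ofBCF.continuous) j).trans ?_
  rw [← ENNReal.tsum_mul_left]
  refine ENNReal.tsum_le_tsum fun l => ?_
  simp only [Function.comp_apply]
  split_ifs with h
  · exact hmul l h
  · rw [map_zero, modNorm_zero]; exact zero_le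

theorem summable_ite_mul {w : J × J → Prop} [DecidablePred w] {u v : J → Eu d →ᵇ ℂ}
    (hu : Summable fun j => ‖u j‖) (hv : Summable fun j => ‖v j‖) :
    Summable fun x : J × J => if w x then u x.1 * v x.2 else 0 := by
  have h1 := (hu.mul_of_nonneg hv (fun _ => norm_nonneg _) (fun _ => norm_nonneg _))
  refine Summable.of_norm_bounded h1 fun x => ?_
  split_ifs
  · exact norm_mul_le _ _
  · rw [norm_zero]; positivity

/-- The product of two series, arranged according to the higher of the two scales. -/
theorem hasSum_mul_by_max [DecidableLE J] [DecidableLT J] {u v : J → Eu d →ᵇ ℂ}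
    (hu : Summable fun j => ‖u j‖) (hv : Summable fun j => ‖v j‖) :
    (∀ j, Summable fun l => if l ≤ j then u j * v l else 0) ∧
    (∀ j, Summable fun l => if l < j then v j * u l else 0) ∧
    HasSum (fun j => (∑' l, if l ≤ j then u j * v l else 0) +
      ∑' l, if l < j then v j * u l else 0) ((∑' j, u j) * ∑' j, v j) := by
  have hP := summable_ite_mul (w := fun x : J × J => x.2 ≤ x.1) hu hv
  -- Strict here and non-strict in `hP`, so that the diagonal is counted once.
  have hQ := summable_ite_mul (w := fun x : J × J => x.2 < x.1) hv hu
  have hPn := hP.prod_factor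
  have hQn := hQ.prod_factor
  refine ⟨hPn, hQn, ?_⟩
  have h1 := (hP.hasSum.prod_fiberwise fun j => (hPn j).hasSum).add
    (hQ.hasSum.prod_fiberwise fun j => (hQn j).hasSum)
  have h2 : (∑' x : J × J, if x.2 ≤ x.1 then u x.1 * v x.2 else 0) +
      (∑' x : J × J, if x.2 < x.1 then v x.1 * u x.2 else 0) = (∑' j, u j) * ∑' j, v j := by
    have hQ' : Summable fun x : J × J => if x.1 < x.2 then v x.2 * u x.1 else 0 :=
      (Equiv.prodComm J J).summable_iff.2 hQ
    have e : (∑' x : J × J, if x.2 < x.1 then v x.1 * u x.2 else 0) =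
        ∑' x : J × J, if x.1 < x.2 then v x.2 * u x.1 else 0 :=
      ((Equiv.prodComm J J).tsum_eq fun x : J × J => if x.2 < x.1 then v x.1 * u x.2 else 0).symm
    rw [e, ← hP.tsum_add hQ', tsum_mul_tsum_of_summable_norm hu hv]
    refine tsum_congr fun x => ?_
    by_cases h : x.2 ≤ x.1
    · simp [h, not_lt.2 h]
    · simp [h, not_le.1 h, mul_comm]
  rwa [h2] at h1

/-- Arranged by the higher scale, the component of the product at `j` has norm at most `C₂ (‖u_j‖ B
+ ‖v_j‖ A)`. Here `A` and `B` do not depend on `j`, so the weighted `ℓ^r` norm passes to `u` and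
`v`, and `WeightControl` bounds `A` and `B`. -/
theorem IsWindow.exists_scalingNorm_mul_le_decompNorm (hψ : IsWindow ψ) (hp : p ≠ ∞) (hr : 1 ≤ r)
    (hw : WeightControl J r μ (d * (p⁻¹).toReal)) : ∃ C : ℝ≥0, ∀ (F G : J → 𝓢'(Eu d, ℂ))
    (U V : Eu d →ᵇ ℂ), HasSum F (ofBCF U) → HasSum G (ofBCF V) → decompNorm ψ p r μ F ≠ ∞ →
    decompNorm ψ p r μ G ≠ ∞ → scalingNorm ψ J p 1 r μ (ofBCF (U * V)) ≤
      C * decompNorm ψ p r μ F * decompNorm ψ p r μ G := by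
  classical
  obtain ⟨C₁, hC₁, hbcf⟩ := hψ.exists_decomp_bcf hp hr hw
  obtain ⟨C₂, hmul⟩ := hψ.exists_modNorm_mul_le (p := p) hp
  obtain ⟨C₀, hC₀, hctrl⟩ := hw
  lift C₀ to ℝ≥0 using hC₀
  refine ⟨2 * C₂ * C₀, fun F G U V hF hG hFt hGt => ?_⟩
  obtain ⟨u, hu, hub⟩ := hbcf F hFt
  obtain ⟨v, hv, hvb⟩ := hbcf G hGt
  obtain rfl : F = fun j => ofBCF (u j) := (funext hu).symm
  obtain rfl : G = fun j => ofBCF (v j) := (funext hv).symm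
  have hu1 : ∑' j, ‖u j‖ₑ ≠ ∞ := ne_top_of_le_ne_top (ENNReal.mul_ne_top hC₁ hFt) hub
  have hv1 : ∑' j, ‖v j‖ₑ ≠ ∞ := ne_top_of_le_ne_top (ENNReal.mul_ne_top hC₁ hGt) hvb
  obtain rfl : ∑' j, u j = U := ofBCF_injective ((hasSum_ofBCF hu1).unique hF)
  obtain rfl : ∑' j, v j = V := ofBCF_injective ((hasSum_ofBCF hv1).unique hG)
  obtain ⟨hP, hQ, hH⟩ := hasSum_mul_by_max (summable_norm_of_tsum_enorm_ne_top hu1)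
    (summable_norm_of_tsum_enorm_ne_top hv1)
  have hFn := modNorm_ne_top_of_decompNorm hr hFt
  have hGn := modNorm_ne_top_of_decompNorm hr hGt
  have hA := hctrl fun j => modNorm ψ p 1 (j : ℤ) (ofBCF (u j))
  have hB := hctrl fun j => modNorm ψ p 1 (j : ℤ) (ofBCF (v j))
  set A := ∑' j : J, (2 : ℝ≥0∞) ^ (((j : ℤ) : ℝ) * (d * (p⁻¹).toReal)) *
    modNorm ψ p 1 (j : ℤ) (ofBCF (u j))
  set B := ∑' j : J, (2 : ℝ≥0∞) ^ (((j : ℤ) : ℝ) * (d * (p⁻¹).toReal)) *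
    modNorm ψ p 1 (j : ℤ) (ofBCF (v j))
  have hHb : ∀ j : J, modNorm ψ p 1 (j : ℤ) (ofBCF ((∑' l, if l ≤ j then u j * v l else 0) +
      ∑' l, if l < j then v j * u l else 0)) ≤
      C₂ * modNorm ψ p 1 (j : ℤ) (ofBCF (u j)) * B +
        C₂ * modNorm ψ p 1 (j : ℤ) (ofBCF (v j)) * A := by
    intro j
    rw [map_add]
    refine (modNorm_add_le _ _ _).trans (add_le_add ?_ ?_)
    · exact modNorm_tsum_ite_mul_le (fun l h => hmul l j (u j) (v l) h (hFn j) (hGn l)) (hP j)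
    · exact modNorm_tsum_ite_mul_le
        (fun l (h : l < j) => hmul l j (v j) (u l) h.le (hGn j) (hFn l)) (hQ j)
  refine (scalingNorm_le (hH.map ofBCF ofBCF.continuous)).trans ?_
  calc decompNorm ψ p r μ (ofBCF ∘ fun j => (∑' l, if l ≤ j then u j * v l else 0) +
          ∑' l, if l < j then v j * u l else 0)
      ≤ ellNorm r (fun j : J =>
          (C₂ * B) * ((2 : ℝ≥0∞) ^ (((j : ℤ) : ℝ) * μ) * modNorm ψ p 1 (j : ℤ) (ofBCF (u j))) +
          (C₂ * A) * ((2 : ℝ≥0∞) ^ (((j : ℤ) : ℝ) * μ) * modNorm ψ p 1 (j : ℤ) (ofBCF (v j)))) := by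
        refine ellNorm_mono hr fun j => (mul_le_mul_right (hHb j) _).trans (le_of_eq ?_)
        ring
    _ ≤ (C₂ * B) * decompNorm ψ p r μ (fun j => ofBCF (u j)) +
          (C₂ * A) * decompNorm ψ p r μ (fun j => ofBCF (v j)) := by
        refine (ellNorm_add_le hr _ _).trans (le_of_eq ?_)
        rw [ellNorm_mul_left hr, ellNorm_mul_left hr]
        rfl
    _ ≤ (C₂ * (C₀ * decompNorm ψ p r μ fun j => ofBCF (v j))) *
            decompNorm ψ p r μ (fun j => ofBCF (u j)) +
          (C₂ * (C₀ * decompNorm ψ p r μ fun j => ofBCF (u j))) *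
            decompNorm ψ p r μ (fun j => ofBCF (v j)) := by
        gcongr
        · exact hB
        · exact hA
    _ = _ := by
        push_cast
        ring

theorem IsWindow.isBanachAlgebra_scalingNorm (hψ : IsWindow ψ) (hp : p ≠ ∞) (hr : 1 ≤ r)
    (hw : WeightControl J r μ (d * (p⁻¹).toReal)) :
    IsBanachAlgebra (scalingNorm ψ J p 1 r μ) where
  smul := scalingNorm_smul hr
  add_le := hψ.scalingNorm_add_le hp hr hw
  eq_zero f hf := by
    obtain ⟨C, hC, h⟩ := hψ.exists_bcf hp hr hw
    obtain ⟨u, rfl, hu⟩ := h f (by simp [hf])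
    rw [hf, mul_zero, nonpos_iff_eq_zero, enorm_eq_zero] at hu
    rw [hu, map_zero]
  complete := hψ.scalingNorm_complete hp hr hw
  bounded_continuous f hf := by
    obtain ⟨C, hC, h⟩ := hψ.exists_bcf hp hr hw
    obtain ⟨u, hu, -⟩ := h f hf.ne
    exact ⟨u, isRepresentedBy_iff.2 hu⟩
  mul := by
    obtain ⟨C, hC⟩ := hψ.exists_scalingNorm_mul_le_decompNorm hp hr hw
    refine ⟨C, fun f g u v hf hg hu hv => ⟨ofBCF (u * v), isRepresentedBy_iff.2 rfl, ?_⟩⟩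
    rw [isRepresentedBy_iff] at hu hv
    have key : scalingNorm ψ J p 1 r μ (ofBCF (u * v)) ≤
        C * scalingNorm ψ J p 1 r μ f * scalingNorm ψ J p 1 r μ g := by
      -- The two infima are approached one factor at a time, first over decompositions of `g`, then
      -- of `f`.
      refine le_mul_of_forall_gt (by finiteness) hg.ne fun y hy => ?_
      obtain ⟨G, hG, hGy⟩ := exists_decomp hy
      refine le_trans ?_ (mul_le_mul_right hGy.le _)
      rw [mul_right_comm]
      refine le_mul_of_forall_gt (by have := hGy.ne_top; finiteness) hf.ne fun x hx => ?_
      obtain ⟨F, hF, hFx⟩ := exists_decomp hx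
      refine (hC F G u v (hu ▸ hF) (hv ▸ hG) hFx.ne_top hGy.ne_top).trans ?_
      rw [mul_right_comm]
      gcongr
    exact ⟨key.trans_lt (by have := hf.ne; have := hg.ne; finiteness), key⟩

end Algebra

end ScalingLimit

end

theorem proposition6p4 {d : ℕ} (hd : 0 < d) {ψ : ScalingLimit.Eu d → ℝ}
    (hψ : ScalingLimit.IsWindow ψ) {p p' : ℝ≥0∞} [Fact (1 ≤ p)] (hp : p ≠ ∞)
    (hpp' : ENNReal.HolderConjugate p p') :
    ScalingLimit.IsBanachAlgebra (ScalingLimit.fullNorm ψ p 1 1 (d * (p⁻¹).toReal)) ∧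
    (∀ μ : ℝ, μ ∈ Set.Icc (d * (p⁻¹).toReal) (max (d * (p⁻¹).toReal) (d * (p'⁻¹).toReal)) →
      ScalingLimit.IsBanachAlgebra (ScalingLimit.roughNorm ψ p 1 1 μ)) ∧
    (∀ r : ℝ, 1 < r → p' < p → ∀ μ : ℝ, d * (p⁻¹).toReal < μ → μ ≤ d * (p'⁻¹).toReal →
      ScalingLimit.IsBanachAlgebra (ScalingLimit.roughNorm ψ p 1 r μ)) :=
  ⟨hψ.isBanachAlgebra_scalingNorm hp le_rfl (ScalingLimit.weightControl_self _ _),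
    fun _ hμ => hψ.isBanachAlgebra_scalingNorm hp le_rfl (ScalingLimit.weightControl_one hμ.1),
    fun _ hr _ _ hμ _ => hψ.isBanachAlgebra_scalingNorm hp hr.le
      (ScalingLimit.weightControl_of_lt hr hμ)⟩
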